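/- Fix an even, non-negative $\chi\in C_0^\infty((-2,2))$ with $\chi(t)=1$ for $|t|\le 1$, and put $\psi(t)=\chi(t)-\chi(2t)$, $\psi_1=\chi$, and $\psi_N(t)=\psi(N^{-1}t)$ for dyadic $N\ge 2$ (dyadic numbers are $1,2,4,\dots$). For $u\in L^2(\mathbb R\times\mathbb R^d;\mathbb C)$, let $\widetilde u(\tau,\xi)$ be its space-time Fourier transform (with kernel $e^{-i(t\tau+x\cdot\xi)}$), and define $P_N$ and, for $\sigma\in\mathbb R$, $Q^\sigma_L$ by $$\widetilde{P_Nu}(\tau,\xi)=\psi_N(|\xi|)\,\widetilde u(\tau,\xi),\qquad \widetilde{Q^\sigma_Lu}(\tau,\xi)=\psi_L(\tau+\sigma|\xi|^2)\,\widetilde u(\tau,\xi).$$ Let $d\ge 1$ be an integer and let $\sigma_1,\sigma_2\in\mathbb R\setminus\{0\}$ satisfy $\sigma_1+\sigma_2\ne 0$. Then there are constants $K$ and $C>0$, depending only on $d,\sigma_1,\sigma_2,\chi$, such that the following holds for all dyadic $N_1,N_2,N_3,L_1,L_2$ and all $u_1,u_2\in L^2(\mathbb R\times\mathbb R^d;\mathbb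 C)$. Put $N_{\min}=\min_i N_i$ and $N_{\max}=\max_i N_i$; if $d=1$, assume in addition that $N_{\max}\ge K N_{\min}$ (for $d\ge 2$ there is no such condition). Then the product $Q_{L_1}^{\sigma_1}P_{N_1}u_1\cdot Q_{L_2}^{\sigma_2}P_{N_2}u_2$ belongs to $L^2(\mathbb R\times\mathbb R^d)$, and $$\|P_{N_3}(Q_{L_1}^{\sigma_1}P_{N_1}u_1\cdot Q_{L_2}^{\sigma_2}P_{N_2}u_2)\|_{L^2}\le C\,N_{\min}^{\frac d2-1}\Big(\frac{N_{\min}}{N_{\max}}\Big)^{\frac12}L_1^{\frac12}L_2^{\frac12}\,\|Q_{L_1}^{\sigma_1}P_{N_1}u_1\|_{L^2}\,\|Q_{L_2}^{\sigma_2}P_{N_2}u_2\|_{L^2}.$$ -/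

import Mathlib

open MeasureTheory FourierTransform
open scoped ENNReal

noncomputable section

/-- Space-time `ℝ × ℝ^d` with its Euclidean structure; a point is `(t, x)`, a frequency `(τ, ξ)`.
Its `volume` is Lebesgue measure. -/
abbrev SpaceTime (d : ℕ) : Type := WithLp 2 (ℝ × EuclideanSpace ℝ (Fin d))

/-- The space `L²(ℝ × ℝ^d; ℂ)`. -/
abbrev L2tx (d : ℕ) : Type := Lp (α := SpaceTime d) ℂ 2 volume

/-- The dyadic numbers `1, 2, 4, …`. -/
def IsDyadic (N : ℝ) : Prop := ∃ n : ℕ, N = 2 ^ n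

/-- An even, non-negative `χ ∈ C₀^∞((-2,2))` with `χ = 1` on `[-1,1]`. -/
structure Cutoff where
  toFun : ℝ → ℝ
  smooth : ContDiff ℝ (⊤ : ℕ∞) toFun
  tsupport_subset : tsupport toFun ⊆ Set.Ioo (-2) 2
  even : ∀ t, toFun (-t) = toFun t
  nonneg : ∀ t, 0 ≤ toFun t
  eq_one : ∀ t, |t| ≤ 1 → toFun t = 1

namespace Cutoff

/-- `ψ(t) = χ(t) - χ(2t)`. -/
def psi (χ : Cutoff) (t : ℝ) : ℝ := χ.toFun t - χ.toFun (2 * t)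

open Classical in
/-- `ψ_1 = χ` and `ψ_N(t) = ψ(N⁻¹ t)` for dyadic `N ≥ 2`. -/
def psiN (χ : Cutoff) (N t : ℝ) : ℝ := if N = 1 then χ.toFun t else χ.psi (N⁻¹ * t)

theorem continuous_psiN (χ : Cutoff) (N : ℝ) : Continuous (χ.psiN N) := by
  have h : Continuous χ.toFun := χ.smooth.continuous
  unfold psiN psi
  split_ifs <;> fun_prop

theorem exists_bound (χ : Cutoff) : ∃ B : ℝ, ∀ t, ‖χ.toFun t‖ ≤ B := by
  have hc : HasCompactSupport χ.toFun :=
    Metric.isCompact_of_isClosed_isBounded (isClosed_tsupport _)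
      ((Metric.isBounded_Ioo (-2 : ℝ) 2).subset χ.tsupport_subset)
  exact hc.exists_bound_of_continuous χ.smooth.continuous

theorem exists_bound_psiN (χ : Cutoff) (N : ℝ) : ∃ B : ℝ, ∀ t, ‖χ.psiN N t‖ ≤ B := by
  obtain ⟨B, hB⟩ := χ.exists_bound
  refine ⟨B + B, fun t => ?_⟩
  unfold psiN psi
  split_ifs
  · have h0 : 0 ≤ B := (norm_nonneg _).trans (hB t)
    linarith [hB t]
  · exact (norm_sub_le _ _).trans (add_le_add (hB _) (hB _))

theorem memLp_symbol (χ : Cutoff) {d : ℕ} (N : ℝ) {g : SpaceTime d → ℝ} (hg : Continuous g) :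
    MemLp (fun z => (χ.psiN N (g z) : ℂ)) ∞ (volume : Measure (SpaceTime d)) := by
  obtain ⟨B, hB⟩ := χ.exists_bound_psiN N
  refine memLp_top_of_bound ?_ B (Filter.Eventually.of_forall fun z => ?_)
  · exact (Complex.continuous_ofReal.comp
      ((χ.continuous_psiN N).comp hg)).aestronglyMeasurable
  · simpa using hB (g z)

end Cutoff

/-- The Fourier multiplier on `L²(ℝ × ℝ^d)` with bounded symbol `m`, where `m` is written in the
variables of `𝓕 u (ζ) = ∫ exp (-2πi ⟪z, ζ⟫) u(z) dz`. -/
def fourierMult {d : ℕ} (m : SpaceTime d → ℂ) (hm : MemLp m ∞ volume) (u : L2tx d) : L2tx d :=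
  𝓕⁻ ((hm.toLp m • 𝓕 u : L2tx d))

/-- The angular spatial frequency `|ξ|` of the convention `exp (-i (tτ + x·ξ))`, at the point `ζ` of
the frequency space of `𝓕`: `(τ, ξ) = 2π ζ`. -/
def freq {d : ℕ} (ζ : SpaceTime d) : ℝ := 2 * Real.pi * ‖ζ.snd‖

/-- The modulation `τ + σ |ξ|²` with `(τ, ξ) = 2π ζ`, in the same convention. -/
def modulation {d : ℕ} (σ : ℝ) (ζ : SpaceTime d) : ℝ := 2 * Real.pi * ζ.fst + σ * freq ζ ^ 2

theorem continuous_freq {d : ℕ} : Continuous (freq (d := d)) := by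
  unfold freq
  fun_prop

theorem continuous_modulation {d : ℕ} (σ : ℝ) : Continuous (modulation (d := d) σ) := by
  have := continuous_freq (d := d)
  unfold modulation
  fun_prop

/-- The frequency projection `P_N`, with symbol `ψ_N(|ξ|)`. -/
def P {d : ℕ} (χ : Cutoff) (N : ℝ) (u : L2tx d) : L2tx d :=
  fourierMult (fun ζ => (χ.psiN N (freq ζ) : ℂ)) (χ.memLp_symbol N continuous_freq) u

/-- The modulation projection `Q_L^σ`, with symbol `ψ_L(τ + σ|ξ|²)`. -/
def Q {d : ℕ} (χ : Cutoff) (σ L : ℝ) (u : L2tx d) : L2tx d :=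
  fourierMult (fun ζ => (χ.psiN L (modulation σ ζ) : ℂ))
    (χ.memLp_symbol L (continuous_modulation σ)) u

end

/-!
The estimate is proved on the Fourier side. Let `v` and `w` be the two factors. Their Fourier
transforms `f` and `g` are supported in the bounded regions where the spatial frequency has size
`Nᵢ` and the modulation is at most `2 Lᵢ`, hence lie in `L¹ ∩ L²`. There the `L²` Fourier transform
is the Fourier integral, so `v * w` is the inverse Fourier transform of `f ⋆ g`
(`exists_memLp_fourier_mul_ae_eq`). Moreover `f ⋆ g` is in `L²` by Cauchy–Schwarz
(`memLp_convolution`), which shows that the product is in `L²`. By Plancherel it remains to bound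
`f ⋆ g` in `L²` of the frequency shell of size `N₃`.

By Cauchy–Schwarz (`setLIntegral_sq_convolution_le`) one has to bound, uniformly in `ζ = (τ, ξ)`, the
volume of the set of those `z = (τ₁, ξ₁)` for which `z` and `ζ - z` lie in the two regions. For fixed
`ξ₁` the variable `τ₁` runs through an interval of length `≲ min L₁ L₂`, and `ξ₁` is confined to
`|φ(ξ₁)| ≲ max L₁ L₂`, where up to a constant depending on `ζ` the resonance function is
`φ(ξ₁) = σ₁ |ξ₁|² + σ₂ |ξ - ξ₁|² = (σ₁ + σ₂) |ξ₁ - c ξ|² + const`, with `c = σ₂ / (σ₁ + σ₂)`. This set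
is a spherical shell (`volume_modulation_le`). There are two cases.

* If `N_max ≥ K N_min`, then the gradient `2 (σ₁ ξ₁ - σ₂ ξ₂)`, `ξ₂ = ξ - ξ₁`, of `φ` has size `N_max`,
  whichever frequency is the smallest (`gradient_lower_bound`; this uses `σ₁`, `σ₂`, `σ₁ + σ₂ ≠ 0`).
  The shell then meets a ball of radius `N_min` in volume at most a constant times
  `N_min ^ (d - 1) * max L₁ L₂ / N_max` (`volume_shell_inter_closedBall_le`). If `N_min` is `N₁` or
  `N₂`, then `ξ₁` lies in such a ball. If `N_min` is `N₃`, then `f` and `g` are decomposed into pieces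
  of spatial frequency width `N₃`, which interact almost diagonally
  (`setLIntegral_sq_convolution_le_of_local`).
* If `N_max < K N_min`, then `d ≥ 2` and the full shell of radius `≲ N_min` has volume at most a
  constant times `N_min ^ (d - 2) * max L₁ L₂` (`volume_shell_le`).
-/

/-! ### The Fourier transform of a product of two `L²` functions -/

section FourierProduct

open Convolution ContinuousLinearMap

variable {E : Type*} [NormedAddCommGroup E] [InnerProductSpace ℝ E] [FiniteDimensional ℝ E]
  [MeasurableSpace E] [BorelSpace E]

theorem continuous_fourierInv_of_integrable {f : E → ℂ} (hf : Integrable f) :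
    Continuous (𝓕⁻ f) := by
  have h : Continuous (𝓕 f) :=
    VectorFourier.fourierIntegral_continuous Real.continuous_fourierChar
      (by exact continuous_inner) hf
  rw [show 𝓕⁻ f = fun x => 𝓕 f (-x) from funext (Real.fourierInv_eq_fourier_neg f)]
  fun_prop

theorem integral_fourierInv_mul_eq_of_integrable {f g : E → ℂ} (hf : Integrable f)
    (hg : Integrable g) : ∫ x, 𝓕⁻ g x * f x = ∫ x, g x * 𝓕⁻ f x := by
  rw [Real.fourierInv_eq_fourier_comp_neg g]
  have h : ∫ x, 𝓕 (fun y => g (-y)) x • f x = ∫ x, g (-x) • 𝓕 f x := by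
    simpa using! VectorFourier.integral_fourierIntegral_smul_eq_flip (L := innerₗ E)
      Real.continuous_fourierChar continuous_inner hg.comp_neg hf
  simp only [smul_eq_mul] at h
  rw [h, ← integral_neg_eq_self]
  simp [Real.fourierInv_eq_fourier_neg]

/-- On `L¹ ∩ L²`, the inverse Fourier transform of `L²`, defined by density, is given by the
Fourier integral: both define the same tempered distribution. -/
theorem coeFn_fourierInv_ae_eq (f : Lp (α := E) ℂ 2) (hf : Integrable f) :
    (𝓕⁻ f : Lp (α := E) ℂ 2) =ᵐ[volume] 𝓕⁻ (f : E → ℂ) := by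
  refine ae_eq_of_integral_contDiff_smul_eq ((Lp.memLp _).locallyIntegrable (by norm_num))
    (continuous_fourierInv_of_integrable hf).locallyIntegrable fun g g_smooth g_cpt => ?_
  have hg₁ : HasCompactSupport (Complex.ofRealCLM ∘ g) := g_cpt.comp_left rfl
  have hg₂ : ContDiff ℝ (⊤ : ℕ∞) (Complex.ofRealCLM ∘ g) := by fun_prop
  set G := hg₁.toSchwartzMap hg₂ with hG
  have key := congrArg (fun T => T G) (Lp.fourierInv_toTemperedDistribution_eq f)
  simp only [TemperedDistribution.fourierInv_apply, Lp.toTemperedDistribution_apply] at key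
  have h2 := integral_fourierInv_mul_eq_of_integrable hf G.integrable
  rw [SchwartzMap.fourierInv_coe] at key
  simp only [smul_eq_mul] at key
  rw [h2] at key
  simpa [hG] using key.symm

/-- If `f` and `g` are in `L¹ ∩ L²` and their convolution is in `L²`, then the product of the `L²`
functions with Fourier transforms `f` and `g` is in `L²`, with Fourier transform `f ⋆ g`. -/
theorem exists_memLp_fourier_mul_ae_eq (v w : Lp (α := E) ℂ 2)
    (hv : Integrable (𝓕 v : Lp (α := E) ℂ 2) volume) (hw : Integrable (𝓕 w : Lp (α := E) ℂ 2) volume)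
    (hc : MemLp ((𝓕 v : Lp (α := E) ℂ 2) ⋆[mul ℂ ℂ, volume] (𝓕 w : Lp (α := E) ℂ 2)) 2 volume) :
    ∃ h : MemLp (fun z => v z * w z) 2 volume,
      (𝓕 (h.toLp _) : Lp (α := E) ℂ 2 volume) =ᵐ[volume]
        ((𝓕 v : Lp (α := E) ℂ 2) ⋆[mul ℂ ℂ, volume] (𝓕 w : Lp (α := E) ℂ 2)) := by
  have hci := hv.integrable_convolution (mul ℂ ℂ) hw
  have e1 := coeFn_fourierInv_ae_eq _ hv
  have e2 := coeFn_fourierInv_ae_eq _ hw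
  rw [fourierInv_fourier_eq] at e1 e2
  have e3 := coeFn_fourierInv_ae_eq (hc.toLp _) (hci.congr hc.coeFn_toLp.symm)
  have e4 : (fun z => v z * w z) =ᵐ[volume] (𝓕⁻ (hc.toLp _) : Lp (α := E) ℂ 2 volume) := by
    filter_upwards [e1, e2, e3] with x h1 h2 h3
    rw [h1, h2, h3, Real.fourierInv_congr_ae hc.coeFn_toLp, Real.fourierInv_eq_fourier_neg,
      Real.fourierInv_eq_fourier_neg, Real.fourierInv_eq_fourier_neg,
      Real.fourier_mul_convolution_eq hv hw]
  have h : MemLp (fun z => v z * w z) 2 volume := (Lp.memLp _).ae_eq e4.symm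
  refine ⟨h, ?_⟩
  have : h.toLp _ = 𝓕⁻ (hc.toLp _) := Lp.ext (h.coeFn_toLp.trans e4)
  rw [this, fourier_fourierInv_eq]
  exact hc.coeFn_toLp

end FourierProduct

/-! ### Square-integral bounds for convolutions with restricted supports -/

section ConvolutionBounds

variable {X Y : Type*} [MeasurableSpace X] [MeasurableSpace Y] {μ : Measure X} {ν : Measure Y}

theorem ENNReal.sq_rpow_one_half (a : ℝ≥0∞) : (a ^ (1 / 2 : ℝ)) ^ 2 = a := by
  rw [← ENNReal.rpow_natCast, ← ENNReal.rpow_mul]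
  norm_num

theorem sq_lintegral_mul_le {f g : X → ℝ≥0∞} (hf : AEMeasurable f μ) (hg : AEMeasurable g μ) :
    (∫⁻ x, f x * g x ∂μ) ^ 2 ≤ (∫⁻ x, f x ^ 2 ∂μ) * ∫⁻ x, g x ^ 2 ∂μ := by
  have h := ENNReal.lintegral_mul_le_Lp_mul_Lq μ Real.HolderConjugate.two_two hf hg
  have h2 := pow_le_pow_left' h 2
  simpa only [Pi.mul_apply, mul_pow, ENNReal.sq_rpow_one_half, ENNReal.rpow_two] using h2

/-- Minkowski's integral inequality in `L²`. -/
theorem lintegral_sq_lintegral_le [SFinite μ] [SFinite ν] {H : Y → X → ℝ≥0∞}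
    (hH : Measurable (Function.uncurry H)) :
    ∫⁻ x, (∫⁻ y, H y x ∂ν) ^ 2 ∂μ ≤ (∫⁻ y, (∫⁻ x, H y x ^ 2 ∂μ) ^ (1 / 2 : ℝ) ∂ν) ^ 2 := by
  set a : Y → ℝ≥0∞ := fun y => (∫⁻ x, H y x ^ 2 ∂μ) ^ (1 / 2 : ℝ)
  have hHy (y : Y) : Measurable (H y) := hH.comp measurable_prodMk_left
  have hHx (x : X) : Measurable fun y => H y x := hH.comp measurable_prodMk_right
  have h3 : Measurable fun p : X × Y × Y => H p.2.1 p.1 * H p.2.2 p.1 :=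
    (hH.comp (measurable_snd.fst.prodMk measurable_fst)).mul
      (hH.comp (measurable_snd.snd.prodMk measurable_fst))
  have pair (y y' : Y) : ∫⁻ x, H y x * H y' x ∂μ ≤ a y * a y' := by
    have h := ENNReal.lintegral_mul_le_Lp_mul_Lq μ Real.HolderConjugate.two_two
      (hHy y).aemeasurable (hHy y').aemeasurable
    simpa only [Pi.mul_apply, ENNReal.rpow_two] using h
  have ha : Measurable a :=
    Measurable.pow_const (Measurable.lintegral_prod_right' (hH.pow_const 2)) _
  calc ∫⁻ x, (∫⁻ y, H y x ∂ν) ^ 2 ∂μ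
      = ∫⁻ x, ∫⁻ q, H q.1 x * H q.2 x ∂ν.prod ν ∂μ := by
        refine lintegral_congr fun x => ?_
        rw [sq, ← lintegral_prod_mul (hHx x).aemeasurable (hHx x).aemeasurable]
    _ = ∫⁻ q, ∫⁻ x, H q.1 x * H q.2 x ∂μ ∂ν.prod ν := lintegral_lintegral_swap h3.aemeasurable
    _ ≤ ∫⁻ q, a q.1 * a q.2 ∂ν.prod ν := lintegral_mono fun q => pair q.1 q.2
    _ = (∫⁻ y, a y ∂ν) ^ 2 := by
        rw [sq, ← lintegral_prod_mul ha.aemeasurable ha.aemeasurable]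

variable {G : Type*} [MeasurableSpace G] [AddCommGroup G] [MeasurableAdd₂ G] [MeasurableNeg G]
  {μ : Measure G} [SFinite μ] [μ.IsAddLeftInvariant]

/-- Cauchy–Schwarz for a convolution: if for every `x ∈ D` the set of those `y` for which
`f y * g (x - y)` does not vanish has measure at most `m`, then
`‖f ⋆ g‖² ≤ m ‖f‖² ‖g‖²` for the `L²` norm over `D` on the left. -/
theorem setLIntegral_sq_convolution_le {f g : G → ℝ≥0∞} (hf : Measurable f) (hg : Measurable g)
    {D : Set G} (hD : MeasurableSet D) {m : ℝ≥0∞}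
    (hm : ∀ x ∈ D, μ {y | f y ≠ 0 ∧ g (x - y) ≠ 0} ≤ m) :
    ∫⁻ x in D, (∫⁻ y, f y * g (x - y) ∂μ) ^ 2 ∂μ ≤
      m * ((∫⁻ x, f x ^ 2 ∂μ) * ∫⁻ x, g x ^ 2 ∂μ) := by
  have hg' : Measurable fun p : G × G => g (p.1 - p.2) := hg.comp measurable_sub
  have hprod : Measurable fun p : G × G => f p.2 ^ 2 * g (p.1 - p.2) ^ 2 :=
    ((hf.comp measurable_snd).pow_const 2).mul (hg'.pow_const 2)
  have key : ∀ x ∈ D, (∫⁻ y, f y * g (x - y) ∂μ) ^ 2 ≤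
      m * ∫⁻ y, f y ^ 2 * g (x - y) ^ 2 ∂μ := by
    intro x hx
    have hgx : Measurable fun y => g (x - y) := hg'.comp measurable_prodMk_left
    have hS : MeasurableSet {y | f y ≠ 0 ∧ g (x - y) ≠ 0} :=
      (hf (measurableSet_singleton 0).compl).inter (hgx (measurableSet_singleton 0).compl)
    set S := {y | f y ≠ 0 ∧ g (x - y) ≠ 0} with hSdef
    have e1 : ∫⁻ y, f y * g (x - y) ∂μ = ∫⁻ y, S.indicator 1 y * (f y * g (x - y)) ∂μ := by
      refine lintegral_congr fun y => ?_
      by_cases hy : y ∈ S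
      · simp [hy]
      · have : f y * g (x - y) = 0 := by
          rw [mul_eq_zero]; by_contra hcon; push Not at hcon; exact hy hcon
        simp [this]
    rw [e1]
    refine (sq_lintegral_mul_le (g := fun y => f y * g (x - y))
      (measurable_one.indicator hS).aemeasurable
      (hf.mul hgx).aemeasurable).trans ?_
    have e2 : ∫⁻ y, S.indicator (1 : G → ℝ≥0∞) y ^ 2 ∂μ = μ S := by
      rw [← lintegral_indicator_one hS]
      refine lintegral_congr fun y => ?_
      by_cases hy : y ∈ S <;> simp [hy]
    rw [e2]
    simp_rw [mul_pow]
    exact mul_le_mul_left (hm x hx) _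
  calc ∫⁻ x in D, (∫⁻ y, f y * g (x - y) ∂μ) ^ 2 ∂μ
      ≤ ∫⁻ x in D, m * ∫⁻ y, f y ^ 2 * g (x - y) ^ 2 ∂μ ∂μ := setLIntegral_mono' hD key
    _ ≤ ∫⁻ x, m * ∫⁻ y, f y ^ 2 * g (x - y) ^ 2 ∂μ ∂μ := setLIntegral_le_lintegral _ _
    _ = m * ∫⁻ x, ∫⁻ y, f y ^ 2 * g (x - y) ^ 2 ∂μ ∂μ :=
        lintegral_const_mul _ hprod.lintegral_prod_right'
    _ = m * ∫⁻ y, ∫⁻ x, f y ^ 2 * g (x - y) ^ 2 ∂μ ∂μ := by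
        rw [lintegral_lintegral_swap hprod.aemeasurable]
    _ = m * ∫⁻ y, f y ^ 2 * ∫⁻ x, g x ^ 2 ∂μ ∂μ := by
        congr 1
        refine lintegral_congr fun y => ?_
        have hgy : Measurable fun x => g (x - y) ^ 2 :=
          (hg.comp (measurable_id.sub_const y)).pow_const 2
        rw [lintegral_const_mul _ hgy,
          lintegral_sub_right_eq_self (fun x => g x ^ 2) y]
    _ = _ := by rw [lintegral_mul_const _ (hf.pow_const 2)]

variable {E : Type*} [NormedAddCommGroup E] [NormedSpace ℝ E] [FiniteDimensional ℝ E]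
  [MeasurableSpace E] [BorelSpace E]

/-- Almost orthogonality: suppose that `D` is contained in the strip `‖p x‖ ≤ 2 r`. Then it suffices
to bound the measure of the part in `‖p y - e‖ ≤ r` of the set where `f y * g (x - y)` does not
vanish, uniformly in `e`, since the pieces `‖p y - e‖ ≤ r` of `f` interact only with the pieces
`‖p y + e‖ ≤ 3 r` of `g`. The decomposition is the continuous one, averaging over all `e`. -/
theorem setLIntegral_sq_convolution_le_of_local {f g : G → ℝ≥0∞} (hf : Measurable f)
    (hg : Measurable g) {D : Set G} (hD : MeasurableSet D) {p : G → E} (hp : Measurable p)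
    (hsub : ∀ x y, p (x - y) = p x - p y) {r : ℝ} (hr : 0 < r) (hDr : ∀ x ∈ D, ‖p x‖ ≤ 2 * r)
    {m : ℝ≥0∞}
    (hm : ∀ e, ∀ x ∈ D, μ {y | ‖p y - e‖ ≤ r ∧ f y ≠ 0 ∧ g (x - y) ≠ 0} ≤ m) :
    ∫⁻ x in D, (∫⁻ y, f y * g (x - y) ∂μ) ^ 2 ∂μ ≤
      3 ^ Module.finrank ℝ E * (m * ((∫⁻ x, f x ^ 2 ∂μ) * ∫⁻ x, g x ^ 2 ∂μ)) := by
  let ν : Measure E := Measure.addHaar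
  set β := ν (Metric.closedBall 0 r) with hβ
  have hβ3 : ν (Metric.closedBall 0 (3 * r)) = 3 ^ Module.finrank ℝ E * β := by
    rw [Measure.addHaar_closedBall_mul ν 0 (by norm_num), ENNReal.ofReal_pow (by norm_num),
      ENNReal.ofReal_ofNat]
    exact hr.le
  have hβ0 : β ≠ 0 := (Metric.measure_closedBall_pos ν 0 hr).ne'
  have hβt : β ≠ ∞ := measure_closedBall_lt_top.ne
  let F (e : E) (y : G) : ℝ≥0∞ := (Metric.closedBall e r).indicator (fun _ => f y) (p y)
  let H (e : E) (y : G) : ℝ≥0∞ := (Metric.closedBall (-e) (3 * r)).indicator (fun _ => g y) (p y)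
  have hFm : Measurable (Function.uncurry F) := by
    have : Function.uncurry F = {q : E × G | dist (p q.2) q.1 ≤ r}.indicator (fun q => f q.2) := by
      ext ⟨e, y⟩; simp [F, Set.indicator]
    rw [this]
    exact (hf.comp measurable_snd).indicator
      (measurableSet_le ((hp.comp measurable_snd).dist measurable_fst) measurable_const)
  have hHm : Measurable (Function.uncurry H) := by
    have : Function.uncurry H =
        {q : E × G | dist (p q.2) (-q.1) ≤ 3 * r}.indicator (fun q => g q.2) := by
      ext ⟨e, y⟩; simp [H, Set.indicator]
    rw [this]
    exact (hg.comp measurable_snd).indicator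
      (measurableSet_le ((hp.comp measurable_snd).dist measurable_fst.neg) measurable_const)
  have hFe (e : E) : Measurable (F e) := hFm.comp measurable_prodMk_left
  have hHe (e : E) : Measurable (H e) := hHm.comp measurable_prodMk_left
  have hconv : Measurable fun q : E × G => ∫⁻ y, F q.1 y * H q.1 (q.2 - y) ∂μ := by
    refine Measurable.lintegral_prod_right'
      (f := fun s : (E × G) × G => F s.1.1 s.2 * H s.1.1 (s.1.2 - s.2)) ?_
    exact (hFm.comp (measurable_fst.fst.prodMk measurable_snd)).mul
      (hHm.comp (measurable_fst.fst.prodMk (measurable_fst.snd.sub measurable_snd)))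
  have avgF : ∫⁻ e, (∫⁻ y, F e y ^ 2 ∂μ) ∂ν = β * ∫⁻ y, f y ^ 2 ∂μ := by
    rw [lintegral_lintegral_swap (hFm.pow_const 2).aemeasurable,
      ← lintegral_const_mul _ (hf.pow_const 2)]
    refine lintegral_congr fun y => ?_
    have : ∀ e, F e y ^ 2 = (Metric.closedBall (p y) r).indicator (fun _ => f y ^ 2) e := by
      intro e
      by_cases h : dist (p y) e ≤ r <;> simp [F, Set.indicator, h, dist_comm e]
    simp_rw [this]
    rw [lintegral_indicator_const Metric.isClosed_closedBall.measurableSet,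
      Measure.addHaar_closedBall_center, mul_comm]
  have avgH : ∫⁻ e, (∫⁻ y, H e y ^ 2 ∂μ) ∂ν =
      3 ^ Module.finrank ℝ E * β * ∫⁻ y, g y ^ 2 ∂μ := by
    rw [lintegral_lintegral_swap (hHm.pow_const 2).aemeasurable,
      ← lintegral_const_mul _ (hg.pow_const 2)]
    refine lintegral_congr fun y => ?_
    have : ∀ e, H e y ^ 2 = (Metric.closedBall (-p y) (3 * r)).indicator (fun _ => g y ^ 2) e := by
      intro e
      have hd : dist e (-p y) = dist (p y) (-e) := by
        rw [dist_eq_norm, dist_eq_norm]; congr 1; abel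
      by_cases h : dist (p y) (-e) ≤ 3 * r <;> simp [H, Set.indicator, h, hd]
    simp_rw [this]
    rw [lintegral_indicator_const Metric.isClosed_closedBall.measurableSet,
      Measure.addHaar_closedBall_center, hβ3, mul_comm]
  have split : ∀ x ∈ D, β * ∫⁻ y, f y * g (x - y) ∂μ ≤
      ∫⁻ e, ∫⁻ y, F e y * H e (x - y) ∂μ ∂ν := by
    intro x hx
    have hm2 : Measurable fun q : E × G => F q.1 q.2 * H q.1 (x - q.2) :=
      hFm.mul (hHm.comp (measurable_fst.prodMk (measurable_snd.const_sub x)))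
    have hgx : Measurable fun y => g (x - y) := hg.comp (measurable_id.const_sub x)
    rw [lintegral_lintegral_swap hm2.aemeasurable,
      ← lintegral_const_mul (f := fun y => f y * g (x - y)) _ (hf.mul hgx)]
    refine lintegral_mono fun y => ?_
    calc β * (f y * g (x - y))
        = ∫⁻ e, (Metric.closedBall (p y) r).indicator (fun _ => f y * g (x - y)) e ∂ν := by
          rw [lintegral_indicator_const Metric.isClosed_closedBall.measurableSet,
            Measure.addHaar_closedBall_center, mul_comm]
      _ ≤ _ := by
          refine lintegral_mono fun e => ?_
          by_cases he : e ∈ Metric.closedBall (p y) r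
          swap
          · simp [Set.indicator_of_notMem he]
          rw [Set.indicator_of_mem he]
          have h1 : p y ∈ Metric.closedBall e r := by rwa [Metric.mem_closedBall, dist_comm]
          have h2 : p (x - y) ∈ Metric.closedBall (-e) (3 * r) := by
            rw [Metric.mem_closedBall, dist_eq_norm] at *
            rw [hsub]
            calc ‖p x - p y - -e‖ = ‖p x - (p y - e)‖ := by congr 1; abel
              _ ≤ ‖p x‖ + ‖p y - e‖ := norm_sub_le _ _
              _ ≤ 3 * r := by linarith [hDr x hx]
          simp [F, H, Set.indicator_of_mem h1, Set.indicator_of_mem h2]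
  have piece (e : E) : ∫⁻ x in D, (∫⁻ y, F e y * H e (x - y) ∂μ) ^ 2 ∂μ ≤
      m * ((∫⁻ y, F e y ^ 2 ∂μ) * ∫⁻ y, H e y ^ 2 ∂μ) := by
    refine setLIntegral_sq_convolution_le (hFe e) (hHe e) hD fun x hx =>
      (measure_mono ?_).trans (hm e x hx)
    rintro y ⟨h1, h2⟩
    simp only [F, H, ne_eq, Set.indicator_apply_eq_zero, not_forall] at h1 h2
    obtain ⟨h1, h1'⟩ := h1
    obtain ⟨h2, h2'⟩ := h2
    exact ⟨by simpa [dist_eq_norm] using h1, h1', h2'⟩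
  have haF : Measurable fun e => (∫⁻ y, F e y ^ 2 ∂μ) ^ (1 / 2 : ℝ) :=
    Measurable.pow_const (Measurable.lintegral_prod_right' (hFm.pow_const 2)) _
  have haH : Measurable fun e => (∫⁻ y, H e y ^ 2 ∂μ) ^ (1 / 2 : ℝ) :=
    Measurable.pow_const (Measurable.lintegral_prod_right' (hHm.pow_const 2)) _
  have main : β ^ 2 * ∫⁻ x in D, (∫⁻ y, f y * g (x - y) ∂μ) ^ 2 ∂μ ≤
      β ^ 2 * (3 ^ Module.finrank ℝ E * (m * ((∫⁻ x, f x ^ 2 ∂μ) * ∫⁻ x, g x ^ 2 ∂μ))) := by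
    calc β ^ 2 * ∫⁻ x in D, (∫⁻ y, f y * g (x - y) ∂μ) ^ 2 ∂μ
        = ∫⁻ x in D, (β * ∫⁻ y, f y * g (x - y) ∂μ) ^ 2 ∂μ := by
          simp_rw [mul_pow]
          rw [lintegral_const_mul']
          exact ENNReal.pow_ne_top hβt
      _ ≤ ∫⁻ x in D, (∫⁻ e, ∫⁻ y, F e y * H e (x - y) ∂μ ∂ν) ^ 2 ∂μ :=
          setLIntegral_mono' hD fun x hx => pow_le_pow_left' (split x hx) 2
      _ ≤ (∫⁻ e, (∫⁻ x in D, (∫⁻ y, F e y * H e (x - y) ∂μ) ^ 2 ∂μ) ^ (1 / 2 : ℝ) ∂ν) ^ 2 :=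
          lintegral_sq_lintegral_le hconv
      _ ≤ (∫⁻ e, m ^ (1 / 2 : ℝ) * ((∫⁻ y, F e y ^ 2 ∂μ) ^ (1 / 2 : ℝ) *
            (∫⁻ y, H e y ^ 2 ∂μ) ^ (1 / 2 : ℝ)) ∂ν) ^ 2 := by
          refine pow_le_pow_left' (lintegral_mono fun e => ?_) 2
          rw [← ENNReal.mul_rpow_of_nonneg _ _ (by norm_num),
            ← ENNReal.mul_rpow_of_nonneg _ _ (by norm_num)]
          exact ENNReal.rpow_le_rpow (piece e) (by norm_num)
      _ = m * (∫⁻ e, (∫⁻ y, F e y ^ 2 ∂μ) ^ (1 / 2 : ℝ) *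
            (∫⁻ y, H e y ^ 2 ∂μ) ^ (1 / 2 : ℝ) ∂ν) ^ 2 := by
          rw [lintegral_const_mul (f := fun e => (∫⁻ y, F e y ^ 2 ∂μ) ^ (1 / 2 : ℝ) *
            (∫⁻ y, H e y ^ 2 ∂μ) ^ (1 / 2 : ℝ)) _ (haF.mul haH), mul_pow, ENNReal.sq_rpow_one_half]
      _ ≤ m * ((∫⁻ e, (∫⁻ y, F e y ^ 2 ∂μ) ∂ν) * ∫⁻ e, (∫⁻ y, H e y ^ 2 ∂μ) ∂ν) := by
          gcongr
          refine (sq_lintegral_mul_le haF.aemeasurable haH.aemeasurable).trans_eq ?_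
          simp_rw [ENNReal.sq_rpow_one_half]
      _ = _ := by rw [avgF, avgH]; ring
  rwa [ENNReal.mul_le_mul_iff_right (by simpa using hβ0) (ENNReal.pow_ne_top hβt)] at main

end ConvolutionBounds

/-! ### Volumes of thin spherical shells -/

section Shells

/-- A product set has measure at most (measure of a set containing its second projection) times
(a bound for the measure of its slices). -/
theorem measure_prod_le_of_slices {X Y : Type*} [MeasurableSpace X] [MeasurableSpace Y]
    {μ : Measure X} {ν : Measure Y} [SFinite μ] [SFinite ν] {S : Set (X × Y)}
    (hS : MeasurableSet S) {T : Set Y} (hT : MeasurableSet T) (hST : ∀ z ∈ S, z.2 ∈ T) {c : ℝ≥0∞}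
    (hc : ∀ y, μ {x | (x, y) ∈ S} ≤ c) : μ.prod ν S ≤ c * ν T := by
  rw [Measure.prod_apply_symm hS, ← lintegral_indicator_const hT]
  refine lintegral_mono fun y => ?_
  by_cases hy : y ∈ T
  · rw [Set.indicator_of_mem hy]
    exact hc y
  · have : (fun x => (x, y)) ⁻¹' S = ∅ :=
      Set.eq_empty_of_forall_notMem fun x hx => hy (hST _ hx)
    simp [this]

/-- On each of the two half-lines `±s ≥ ρ` the points `s`, `t` of the set satisfy
`|s - t| = |s² - t²| / |s + t| ≤ 2 M / (2 ρ)`. -/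
theorem volume_abs_sq_sub_le {ρ M : ℝ} (hρ : 0 < ρ) (b : ℝ) :
    volume {s : ℝ | ρ ≤ |s| ∧ |s ^ 2 - b| ≤ M} ≤ ENNReal.ofReal (2 * (M / ρ)) := by
  have hdiam : ∀ A : Set ℝ, (∀ s ∈ A, ∀ t ∈ A, |s - t| ≤ M / ρ) →
      volume A ≤ ENNReal.ofReal (M / ρ) := by
    intro A hA
    refine (Real.volume_le_diam A).trans (Metric.ediam_le fun s hs t ht => ?_)
    rw [edist_dist, Real.dist_eq]
    exact ENNReal.ofReal_le_ofReal (hA s hs t ht)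
  have hsub : ∀ s t : ℝ, 2 * ρ ≤ |s + t| → |s ^ 2 - b| ≤ M → |t ^ 2 - b| ≤ M →
      |s - t| ≤ M / ρ := by
    intro s t hst hs ht
    rw [le_div_iff₀ hρ]
    have h1 : |s - t| * |s + t| ≤ 2 * M := by
      rw [← abs_mul]
      calc |(s - t) * (s + t)| = |(s ^ 2 - b) - (t ^ 2 - b)| := by ring_nf
        _ ≤ _ := (abs_sub _ _).trans (by linarith)
    nlinarith [abs_nonneg (s - t)]
  have hcover : {s : ℝ | ρ ≤ |s| ∧ |s ^ 2 - b| ≤ M} ⊆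
      {s : ℝ | ρ ≤ s ∧ |s ^ 2 - b| ≤ M} ∪ {s : ℝ | s ≤ -ρ ∧ |s ^ 2 - b| ≤ M} := by
    rintro s ⟨h1, h2⟩
    rcases le_abs.1 h1 with h | h
    · exact Or.inl ⟨h, h2⟩
    · exact Or.inr ⟨by linarith, h2⟩
  refine (measure_mono hcover).trans ((measure_union_le _ _).trans ?_)
  rw [ENNReal.ofReal_mul zero_le_two, ENNReal.ofReal_ofNat, two_mul]
  refine add_le_add (hdiam _ ?_) (hdiam _ ?_)
  · rintro s ⟨h1, h2⟩ t ⟨h3, h4⟩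
    exact hsub s t (by rw [abs_of_nonneg] <;> linarith) h2 h4
  · rintro s ⟨h1, h2⟩ t ⟨h3, h4⟩
    exact hsub s t (by rw [abs_of_nonpos] <;> linarith) h2 h4

/-- The part of a spherical shell that lies in a cube and on which the `i`-th coordinate is at
least `ρ` in absolute value: on each line in direction `i` the derivative of `‖x‖²` is at least
`2 ρ` in absolute value. -/
theorem volume_shell_inter_cube_le {n : ℕ} (i : Fin (n + 1)) (q : Fin (n + 1) → ℝ) {r ρ M : ℝ}
    (hρ : 0 < ρ) (a : ℝ) :
    volume {x : Fin (n + 1) → ℝ | (∀ j, |x j - q j| ≤ r) ∧ ρ ≤ |x i| ∧ |∑ j, x j ^ 2 - a| ≤ M} ≤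
      ENNReal.ofReal (2 * (M / ρ)) * ENNReal.ofReal (2 * r) ^ n := by
  set S := {x : Fin (n + 1) → ℝ | (∀ j, |x j - q j| ≤ r) ∧ ρ ≤ |x i| ∧ |∑ j, x j ^ 2 - a| ≤ M}
  let e := MeasurableEquiv.piFinSuccAbove (fun _ : Fin (n + 1) => ℝ) i
  have he : MeasurePreserving e := volume_preserving_piFinSuccAbove (fun _ => ℝ) i
  have hS : MeasurableSet S := by
    refine IsClosed.measurableSet ?_
    simp only [S, Set.ofPred_and, Set.ofPred_forall]
    refine (isClosed_iInter fun j => ?_).inter (IsClosed.inter ?_ ?_)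
    all_goals exact isClosed_le (by fun_prop) (by fun_prop)
  have hei : ∀ s y, e.symm (s, y) i = s := fun s y => by
    change Fin.insertNthEquiv (fun _ => ℝ) i (s, y) i = s
    simp
  have hej : ∀ s y j, e.symm (s, y) (i.succAbove j) = y j :=
    fun s y j => by
    change Fin.insertNthEquiv (fun _ => ℝ) i (s, y) (i.succAbove j) = y j
    simp
  rw [← he.symm.measure_preimage_equiv]
  have hbox : MeasurableSet (Set.pi Set.univ fun j => Set.Icc (q (i.succAbove j) - r)
      (q (i.succAbove j) + r)) := MeasurableSet.univ_pi fun j => measurableSet_Icc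
  refine (measure_prod_le_of_slices (c := ENNReal.ofReal (2 * (M / ρ)))
    (e.symm.measurable hS) hbox ?_ ?_).trans_eq ?_
  · rintro ⟨s, y⟩ ⟨h1, -⟩ j -
    have := abs_le.1 (h1 (i.succAbove j))
    rw [hej] at this
    exact ⟨by dsimp only; linarith, by dsimp only; linarith⟩
  · intro y
    refine (measure_mono ?_).trans (volume_abs_sq_sub_le hρ (a - ∑ j, y j ^ 2))
    rintro s ⟨-, h2, h3⟩
    simp only [Fin.sum_univ_succAbove _ i, hei, hej] at h2 h3
    exact ⟨h2, by rwa [show s ^ 2 - (a - ∑ j, y j ^ 2) = s ^ 2 + ∑ j, y j ^ 2 - a by ring]⟩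
  · rw [volume_pi_pi]
    simp [Real.volume_Icc, two_mul]

/-- The part in a ball of radius `r`, with arbitrary centre, of a spherical shell whose radii are at
least `ρ`. Some coordinate is at least `ρ / (n + 1)` in absolute value. -/
theorem volume_shell_inter_closedBall_le (n : ℕ) (q : EuclideanSpace ℝ (Fin (n + 1))) {r ρ M : ℝ}
    (hr : 0 ≤ r) (hρ : 0 < ρ) (hM : 0 ≤ M) (a : ℝ) :
    volume {x : EuclideanSpace ℝ (Fin (n + 1)) | ‖x - q‖ ≤ r ∧ ρ ≤ ‖x‖ ∧ |‖x‖ ^ 2 - a| ≤ M} ≤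
      ENNReal.ofReal (((n : ℝ) + 1) ^ 2 * 2 ^ (n + 1) * (M * r ^ n / ρ)) := by
  have hρ' : 0 < ρ / (n + 1) := by positivity
  have hcover : {x : EuclideanSpace ℝ (Fin (n + 1)) | ‖x - q‖ ≤ r ∧ ρ ≤ ‖x‖ ∧ |‖x‖ ^ 2 - a| ≤ M} ⊆
      ⋃ i, (WithLp.ofLp : EuclideanSpace ℝ (Fin (n + 1)) → _) ⁻¹'
        {x : Fin (n + 1) → ℝ | (∀ j, |x j - q j| ≤ r) ∧ ρ / (n + 1) ≤ |x i| ∧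
          |∑ j, x j ^ 2 - a| ≤ M} := by
    rintro x ⟨h1, h2, h3⟩
    have hi : ∃ i, ρ / (n + 1) ≤ |x i| := by
      by_contra! hcon
      have hle : ‖x‖ ≤ ∑ i, |x i| := by
        conv_lhs => rw [← (EuclideanSpace.basisFun (Fin (n + 1)) ℝ).sum_repr x]
        refine (norm_sum_le _ _).trans (Finset.sum_le_sum fun i _ => ?_)
        simp [norm_smul]
      have hlt : ∑ i, |x i| < ∑ _i : Fin (n + 1), ρ / (n + 1) :=
        Finset.sum_lt_sum_of_nonempty Finset.univ_nonempty fun i _ => hcon i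
      have : ∑ _i : Fin (n + 1), ρ / (n + 1) = ρ := by
        rw [Finset.sum_const, Finset.card_univ, Fintype.card_fin, nsmul_eq_mul]
        push_cast
        field_simp
      linarith
    obtain ⟨i, hi⟩ := hi
    refine Set.mem_iUnion.2 ⟨i, fun j => ?_, hi, ?_⟩
    · exact (PiLp.norm_apply_le (x - q) j).trans h1
    · rw [EuclideanSpace.real_norm_sq_eq] at h3
      exact h3
  refine (measure_mono hcover).trans ((measure_iUnion_fintype_le _ _).trans ?_)
  have hbound : ∀ i : Fin (n + 1), volume ((WithLp.ofLp : EuclideanSpace ℝ (Fin (n + 1)) → _) ⁻¹'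
        {x : Fin (n + 1) → ℝ | (∀ j, |x j - q j| ≤ r) ∧ ρ / (n + 1) ≤ |x i| ∧
          |∑ j, x j ^ 2 - a| ≤ M}) ≤
      ENNReal.ofReal (2 * (M / (ρ / (n + 1))) * (2 * r) ^ n) := by
    intro i
    rw [ENNReal.ofReal_mul (by positivity), ENNReal.ofReal_pow (by positivity)]
    refine le_trans (le_of_eq ?_) (volume_shell_inter_cube_le i q hρ' a)
    exact (EuclideanSpace.volume_preserving_symm_measurableEquiv_toLp _).measure_preimage_equiv _
  refine (Finset.sum_le_sum fun i _ => hbound i).trans_eq ?_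
  rw [Finset.sum_const, Finset.card_univ, Fintype.card_fin, nsmul_eq_mul, ← ENNReal.ofReal_natCast,
    ← ENNReal.ofReal_mul (by positivity)]
  congr 1
  push_cast
  field_simp
  ring

/-- In dimension at least two, a full spherical shell `|‖x‖² - a| ≤ M` with radii at most `R`. -/
theorem volume_shell_le (n : ℕ) : ∃ C : ℝ, 0 < C ∧ ∀ R M a : ℝ, 0 ≤ R → 0 ≤ M →
    volume {x : EuclideanSpace ℝ (Fin (n + 2)) | ‖x‖ ≤ R ∧ |‖x‖ ^ 2 - a| ≤ M} ≤
      ENNReal.ofReal (C * (M * R ^ n)) := by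
  set β := volume (Metric.ball (0 : EuclideanSpace ℝ (Fin (n + 2))) 1) with hβ
  have hβt : β ≠ ∞ := measure_ball_lt_top.ne
  have hβ0 : 0 < β.toReal := ENNReal.toReal_pos (Metric.measure_ball_pos _ _ one_pos).ne' hβt
  have hβ' : β = ENNReal.ofReal β.toReal := (ENNReal.ofReal_toReal hβt).symm
  set b := β.toReal
  refine ⟨2 * (n + 2) * b, by positivity, fun R M a hR hM => ?_⟩
  rcases Set.eq_empty_or_nonempty
    {x : EuclideanSpace ℝ (Fin (n + 2)) | ‖x‖ ≤ R ∧ |‖x‖ ^ 2 - a| ≤ M} with h0 | ⟨x₀, hx₀R, hx₀⟩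
  · simp [h0]
  set R₁ := √(a - M)
  set R₂ := √(min (R ^ 2) (a + M))
  have hx₀' := abs_le.1 hx₀
  have hmin : 0 ≤ min (R ^ 2) (a + M) :=
    le_min (sq_nonneg R) (by nlinarith [sq_nonneg ‖x₀‖])
  have h12 : R₁ ≤ R₂ := by
    refine Real.sqrt_le_sqrt (le_min ?_ (by linarith))
    nlinarith [norm_nonneg x₀]
  have hR₁ : 0 ≤ R₁ := Real.sqrt_nonneg _
  have hR₂ : 0 ≤ R₂ := Real.sqrt_nonneg _
  have hR₂R : R₂ ≤ R := by
    refine (Real.sqrt_le_sqrt (min_le_left _ _)).trans_eq (Real.sqrt_sq hR)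
  have hdiff : R₂ ^ 2 - R₁ ^ 2 ≤ 2 * M := by
    have h2 : R₂ ^ 2 ≤ a + M := by rw [Real.sq_sqrt hmin]; exact min_le_right _ _
    have h1 : a - M ≤ R₁ ^ 2 := by
      rcases le_total 0 (a - M) with h | h
      · exact (Real.sq_sqrt h).ge
      · exact h.trans (sq_nonneg R₁)
    linarith
  have hcover : {x : EuclideanSpace ℝ (Fin (n + 2)) | ‖x‖ ≤ R ∧ |‖x‖ ^ 2 - a| ≤ M} ⊆
      Metric.closedBall 0 R₂ \ Metric.ball 0 R₁ := by
    rintro x ⟨h1, h2⟩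
    rw [abs_le] at h2
    refine ⟨?_, ?_⟩
    · rw [mem_closedBall_zero_iff]
      refine Real.le_sqrt_of_sq_le (le_min ?_ (by linarith))
      nlinarith [norm_nonneg x]
    · rw [mem_ball_zero_iff, not_lt]
      exact Real.sqrt_le_iff.2 ⟨norm_nonneg x, by linarith⟩
  refine (measure_mono hcover).trans ?_
  rw [measure_sdiff (Metric.ball_subset_closedBall.trans (Metric.closedBall_subset_closedBall h12))
    measurableSet_ball.nullMeasurableSet measure_ball_lt_top.ne,
    Measure.addHaar_closedBall _ _ hR₂, Measure.addHaar_ball _ _ hR₁, ← hβ,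
    hβ', ← ENNReal.ofReal_mul (by positivity),
    ← ENNReal.ofReal_mul (by positivity), ← ENNReal.ofReal_sub _ (by positivity),
    finrank_euclideanSpace_fin]
  refine ENNReal.ofReal_le_ofReal ?_
  have hpow : R₂ ^ (n + 2) - R₁ ^ (n + 2) ≤ (n + 2) * R₂ ^ (n + 1) * (R₂ - R₁) := by
    have h := abs_pow_sub_pow_le R₂ R₁ (n + 2)
    rw [abs_of_nonneg (sub_nonneg.2 h12), abs_of_nonneg hR₂, abs_of_nonneg hR₁,
      max_eq_left h12] at h
    refine (le_abs_self _).trans (h.trans_eq ?_)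
    push_cast
    ring
  have hstep : R₂ ^ (n + 1) * (R₂ - R₁) ≤ R ^ n * (2 * M) := by
    calc R₂ ^ (n + 1) * (R₂ - R₁) = R₂ ^ n * (R₂ * (R₂ - R₁)) := by ring
      _ ≤ R ^ n * (2 * M) := by
        refine mul_le_mul (pow_le_pow_left₀ hR₂ hR₂R n) ?_ ?_ (by positivity)
        · nlinarith
        · exact mul_nonneg hR₂ (sub_nonneg.2 h12)
  calc R₂ ^ (n + 2) * b - R₁ ^ (n + 2) * b
      = (R₂ ^ (n + 2) - R₁ ^ (n + 2)) * b := by ring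
    _ ≤ ((n + 2) * (R ^ n * (2 * M))) * b := by
        refine mul_le_mul_of_nonneg_right (hpow.trans ?_) hβ0.le
        rw [mul_assoc]
        gcongr
    _ = _ := by ring

end Shells

/-! ### The resonance function -/

section Resonance

/-- Completing the square in the resonance function. -/
theorem sq_norm_add_sq_norm_sub_eq {E : Type*} [NormedAddCommGroup E] [InnerProductSpace ℝ E]
    {σ₁ σ₂ : ℝ} (hσ : σ₁ + σ₂ ≠ 0) (x ξ : E) :
    σ₁ * ‖x‖ ^ 2 + σ₂ * ‖ξ - x‖ ^ 2 =
      (σ₁ + σ₂) * ‖x - (σ₂ / (σ₁ + σ₂)) • ξ‖ ^ 2 + σ₁ * σ₂ / (σ₁ + σ₂) * ‖ξ‖ ^ 2 := by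
  rw [norm_sub_sq_real, norm_sub_sq_real, inner_smul_right, norm_smul, mul_pow, Real.norm_eq_abs,
    sq_abs, real_inner_comm]
  field_simp
  ring

variable {d : ℕ}

/-- The frequencies `z` such that `z` and `ζ - z` have modulations at most `l₁` and `l₂`. In the
time frequency they are confined to an interval of length `min l₁ l₂ / π`, and in the spatial
frequency to a spherical shell around `σ₂ / (σ₁ + σ₂) • ξ`, on which the sum of the two modulations
is at most `l₁ + l₂`. -/
theorem volume_modulation_le {σ₁ σ₂ : ℝ} (hσ : σ₁ + σ₂ ≠ 0) (l₁ l₂ : ℝ) (ζ : SpaceTime d)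
    {U : Set (EuclideanSpace ℝ (Fin d))} (hU : MeasurableSet U) :
    ∃ a : ℝ, volume {z : SpaceTime d | |modulation σ₁ z| ≤ l₁ ∧ |modulation σ₂ (ζ - z)| ≤ l₂ ∧
        z.snd - (σ₂ / (σ₁ + σ₂)) • ζ.snd ∈ U} ≤
      ENNReal.ofReal (min l₁ l₂ / Real.pi) *
        volume {x | x ∈ U ∧ |‖x‖ ^ 2 - a| ≤ (l₁ + l₂) / (4 * Real.pi ^ 2 * |σ₁ + σ₂|)} := by
  set s := σ₁ + σ₂
  set c := σ₂ / s
  set a : ℝ := -(2 * Real.pi * ζ.fst + 4 * Real.pi ^ 2 * (σ₁ * σ₂ / s * ‖ζ.snd‖ ^ 2)) /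
    (4 * Real.pi ^ 2 * s) with ha
  refine ⟨a, ?_⟩
  have hπ := Real.pi_pos
  set S := {z : SpaceTime d | |modulation σ₁ z| ≤ l₁ ∧ |modulation σ₂ (ζ - z)| ≤ l₂ ∧
    z.snd - c • ζ.snd ∈ U}
  set T := {x : EuclideanSpace ℝ (Fin d) | x ∈ U ∧ |‖x‖ ^ 2 - a| ≤
    (l₁ + l₂) / (4 * Real.pi ^ 2 * |s|)}
  have hT : MeasurableSet T :=
    hU.inter (measurableSet_le (f := fun x : EuclideanSpace ℝ (Fin d) => |‖x‖ ^ 2 - a|)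
      (by fun_prop) measurable_const)
  have hS : MeasurableSet S := by
    have h1 : Measurable fun z : SpaceTime d => |modulation σ₁ z| :=
      (continuous_modulation σ₁).abs.measurable
    have h2 : Measurable fun z : SpaceTime d => |modulation σ₂ (ζ - z)| :=
      ((continuous_modulation σ₂).comp (continuous_const.sub continuous_id)).abs.measurable
    have h3 : Measurable fun z : SpaceTime d => z.snd - c • ζ.snd :=
      Continuous.measurable (by fun_prop)
    exact (measurableSet_le h1 measurable_const).inter
      ((measurableSet_le h2 measurable_const).inter (h3 hU))
  have htrans : volume ((fun x => x - c • ζ.snd) ⁻¹' T) = volume T :=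
    (measurePreserving_sub_right volume (c • ζ.snd)).measure_preimage hT.nullMeasurableSet
  rw [← htrans, ← (WithLp.volume_preserving_toLp ℝ (EuclideanSpace ℝ (Fin d))).measure_preimage
    hS.nullMeasurableSet]
  refine measure_prod_le_of_slices
    ((WithLp.volume_preserving_toLp ℝ (EuclideanSpace ℝ (Fin d))).measurable hS)
    ((measurable_id.sub_const _) hT) ?_ ?_
  · rintro ⟨t, x⟩ ⟨h1, h2, h3⟩
    refine ⟨h3, ?_⟩
    -- the sum of the two modulations does not depend on the time frequency `t`
    have hsum : modulation σ₁ (WithLp.toLp 2 (t, x)) + modulation σ₂ (ζ - WithLp.toLp 2 (t, x)) =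
        4 * Real.pi ^ 2 * s * (‖x - c • ζ.snd‖ ^ 2 - a) := by
      have hid := sq_norm_add_sq_norm_sub_eq hσ x ζ.snd
      have hs : 4 * Real.pi ^ 2 * s * a =
          -(2 * Real.pi * ζ.fst + 4 * Real.pi ^ 2 * (σ₁ * σ₂ / s * ‖ζ.snd‖ ^ 2)) := by
        rw [ha, mul_div_cancel₀]
        positivity
      rw [mul_sub, hs]
      simp only [modulation, freq, WithLp.sub_fst, WithLp.sub_snd, WithLp.toLp_fst, WithLp.toLp_snd]
      linear_combination 4 * Real.pi ^ 2 * hid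
    have habs := (abs_add_le _ _).trans (add_le_add h1 h2)
    rw [hsum, abs_mul, abs_mul, abs_of_pos (by positivity : 0 < 4 * Real.pi ^ 2)] at habs
    rw [le_div_iff₀ (by positivity), mul_comm]
    exact habs
  · intro x
    have hlen : ∀ (l b : ℝ) (A : Set ℝ), (∀ t ∈ A, |2 * Real.pi * t - b| ≤ l) →
        volume A ≤ ENNReal.ofReal (l / Real.pi) := by
      intro l b A hA
      have hsub : A ⊆ Set.Icc ((b - l) / (2 * Real.pi)) ((b + l) / (2 * Real.pi)) := by
        intro t ht
        have := abs_le.1 (hA t ht)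
        constructor
        · rw [div_le_iff₀ (by positivity)]; linarith
        · rw [le_div_iff₀ (by positivity)]; linarith
      refine (measure_mono hsub).trans_eq ?_
      rw [Real.volume_Icc]
      congr 1
      field_simp
      ring
    rcases le_total l₁ l₂ with h | h
    · rw [min_eq_left h]
      refine hlen l₁ (-(σ₁ * (2 * Real.pi * ‖x‖) ^ 2)) _ fun t ht => ?_
      have := ht.1
      simp only [modulation, freq] at this
      simpa using this
    · rw [min_eq_right h]
      refine hlen l₂ (2 * Real.pi * ζ.fst + σ₂ * (2 * Real.pi * ‖ζ.snd - x‖) ^ 2) _ fun t ht => ?_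
      have := ht.2.1
      simp only [modulation, freq, WithLp.sub_fst, WithLp.sub_snd, WithLp.toLp_fst,
        WithLp.toLp_snd] at this
      rw [abs_sub_comm]
      convert this using 2
      ring

theorem min_mul_add_le {a b : ℝ} (ha : 0 ≤ a) (hb : 0 ≤ b) : min a b * (a + b) ≤ 2 * (a * b) := by
  rcases le_total a b with h | h
  · rw [min_eq_left h]; nlinarith
  · rw [min_eq_right h]; nlinarith

/-- The set of `volume_modulation_le` with `ξ₁` confined to a ball of radius `r`, in the region where
the gradient of the resonance function is at least `2 |σ₁ + σ₂| ρ`. -/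
theorem volume_modulation_inter_closedBall_le (n : ℕ) {σ₁ σ₂ : ℝ} (hσ : σ₁ + σ₂ ≠ 0) :
    ∃ C : ℝ, 0 < C ∧ ∀ (l₁ l₂ r ρ : ℝ) (ζ : SpaceTime (n + 1)) (q : EuclideanSpace ℝ (Fin (n + 1))),
      0 ≤ l₁ → 0 ≤ l₂ → 0 ≤ r → 0 < ρ →
      volume {z : SpaceTime (n + 1) | |modulation σ₁ z| ≤ l₁ ∧ |modulation σ₂ (ζ - z)| ≤ l₂ ∧
        ‖z.snd - q‖ ≤ r ∧ ρ ≤ ‖z.snd - (σ₂ / (σ₁ + σ₂)) • ζ.snd‖} ≤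
      ENNReal.ofReal (C * (l₁ * l₂ * r ^ n / ρ)) := by
  have hπ := Real.pi_pos
  refine ⟨((n : ℝ) + 1) ^ 2 * 2 ^ (n + 1) * (2 / (Real.pi * (4 * Real.pi ^ 2 * |σ₁ + σ₂|))),
    by positivity, fun l₁ l₂ r ρ ζ q hl₁ hl₂ hr hρ => ?_⟩
  set p := (σ₂ / (σ₁ + σ₂)) • ζ.snd
  have hU : MeasurableSet {x : EuclideanSpace ℝ (Fin (n + 1)) | ‖x - (q - p)‖ ≤ r ∧ ρ ≤ ‖x‖} :=
    (measurableSet_le (f := fun x => ‖x - (q - p)‖) (by fun_prop) measurable_const).inter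
      (measurableSet_le measurable_const measurable_norm)
  obtain ⟨a, ha⟩ := volume_modulation_le hσ l₁ l₂ ζ hU
  refine (measure_mono ?_).trans (ha.trans ?_)
  · rintro z ⟨h1, h2, h3, h4⟩
    exact ⟨h1, h2, (sub_sub_sub_cancel_right z.snd q p).symm ▸ h3, h4⟩
  simp only [Set.mem_ofPred_eq, and_assoc]
  refine (mul_le_mul_right (volume_shell_inter_closedBall_le n (q - p) hr hρ (by positivity) a)
    _).trans ?_
  rw [← ENNReal.ofReal_mul (by positivity)]
  refine ENNReal.ofReal_le_ofReal ?_
  have := min_mul_add_le hl₁ hl₂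
  calc _ = ((n : ℝ) + 1) ^ 2 * 2 ^ (n + 1) * (1 / (Real.pi * (4 * Real.pi ^ 2 * |σ₁ + σ₂|))) *
        ((min l₁ l₂ * (l₁ + l₂)) * r ^ n / ρ) := by field_simp
    _ ≤ ((n : ℝ) + 1) ^ 2 * 2 ^ (n + 1) * (1 / (Real.pi * (4 * Real.pi ^ 2 * |σ₁ + σ₂|))) *
        ((2 * (l₁ * l₂)) * r ^ n / ρ) := by gcongr
    _ = _ := by field_simp

/-- The set of `volume_modulation_le` in dimension at least two, without a lower bound for the gradient
of the resonance function. -/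
theorem volume_modulation_le_of_two_le (n : ℕ) {σ₁ σ₂ : ℝ} (hσ : σ₁ + σ₂ ≠ 0) :
    ∃ C : ℝ, 0 < C ∧ ∀ (l₁ l₂ R : ℝ) (ζ : SpaceTime (n + 2)), 0 ≤ l₁ → 0 ≤ l₂ → 0 ≤ R →
      volume {z : SpaceTime (n + 2) | |modulation σ₁ z| ≤ l₁ ∧ |modulation σ₂ (ζ - z)| ≤ l₂ ∧
        ‖z.snd - (σ₂ / (σ₁ + σ₂)) • ζ.snd‖ ≤ R} ≤
      ENNReal.ofReal (C * (l₁ * l₂ * R ^ n)) := by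
  have hπ := Real.pi_pos
  obtain ⟨C, hC, hvol⟩ := volume_shell_le n
  refine ⟨C * (2 / (Real.pi * (4 * Real.pi ^ 2 * |σ₁ + σ₂|))), by positivity,
    fun l₁ l₂ R ζ hl₁ hl₂ hR => ?_⟩
  have hU : MeasurableSet {x : EuclideanSpace ℝ (Fin (n + 2)) | ‖x‖ ≤ R} :=
    measurableSet_le (by fun_prop) measurable_const
  obtain ⟨a, ha⟩ := volume_modulation_le hσ l₁ l₂ ζ hU
  refine ha.trans ((mul_le_mul_right (hvol R _ a hR (by positivity)) _).trans ?_)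
  rw [← ENNReal.ofReal_mul (by positivity)]
  refine ENNReal.ofReal_le_ofReal ?_
  have := min_mul_add_le hl₁ hl₂
  calc _ = C * (1 / (Real.pi * (4 * Real.pi ^ 2 * |σ₁ + σ₂|))) *
        ((min l₁ l₂ * (l₁ + l₂)) * R ^ n) := by field_simp
    _ ≤ C * (1 / (Real.pi * (4 * Real.pi ^ 2 * |σ₁ + σ₂|))) * ((2 * (l₁ * l₂)) * R ^ n) := by
        gcongr
    _ = _ := by field_simp

end Resonance

/-! ### The bilinear estimate on the Fourier side -/

section FourierSide

variable {d : ℕ}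

/-- The closed set of frequencies containing the support of `ψ_N(|ξ|)` for dyadic `N`; the lower
bound is absent for `N = 1`. -/
def freqShell (d : ℕ) (N : ℝ) : Set (SpaceTime d) :=
  {z | freq z ≤ 2 * N ∧ (2 ≤ N → N / 2 ≤ freq z)}

theorem measurableSet_freqShell (N : ℝ) : MeasurableSet (freqShell d N) := by
  have h := continuous_freq (d := d)
  by_cases hN : 2 ≤ N
  · simp only [freqShell, hN, forall_const]
    exact (measurableSet_le h.measurable measurable_const).inter
      (measurableSet_le measurable_const h.measurable)
  · simp only [freqShell, hN, false_imp_iff, and_true]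
    exact measurableSet_le h.measurable measurable_const

theorem freq_nonneg (z : SpaceTime d) : 0 ≤ freq z := by unfold freq; positivity

theorem freq_add_le (z w : SpaceTime d) : freq (z + w) ≤ freq z + freq w := by
  unfold freq
  rw [← mul_add, WithLp.add_snd]
  gcongr
  exact norm_add_le _ _

theorem freq_neg (z : SpaceTime d) : freq (-z) = freq z := by
  simp [freq]

theorem norm_snd_le_of_freq_le {z : SpaceTime d} {N : ℝ} (h : freq z ≤ 2 * N) : ‖z.snd‖ ≤ N := by
  unfold freq at h
  nlinarith [Real.pi_gt_three, norm_nonneg z.snd]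

/-- Up to a factor `2`, the gradient of the resonance function is
`(σ₁ + σ₂) (ξ₁ - σ₂ / (σ₁ + σ₂) ξ) = σ₁ ξ₁ - σ₂ ξ₂ = (σ₁ + σ₂) ξ₁ - σ₂ ξ`, where `ξ = ξ₁ + ξ₂`; the
lower bounds are triangle inequalities for the last two expressions. -/
theorem le_norm_gradient {σ₁ σ₂ : ℝ} (hσ : σ₁ + σ₂ ≠ 0) (z ζ : SpaceTime d) :
    |σ₂| * freq (ζ - z) - |σ₁| * freq z ≤
      2 * Real.pi * |σ₁ + σ₂| * ‖z.snd - (σ₂ / (σ₁ + σ₂)) • ζ.snd‖ ∧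
    |σ₁| * freq z - |σ₂| * freq (ζ - z) ≤
      2 * Real.pi * |σ₁ + σ₂| * ‖z.snd - (σ₂ / (σ₁ + σ₂)) • ζ.snd‖ ∧
    |σ₁ + σ₂| * freq z - |σ₂| * freq ζ ≤
      2 * Real.pi * |σ₁ + σ₂| * ‖z.snd - (σ₂ / (σ₁ + σ₂)) • ζ.snd‖ := by
  have hπ := Real.pi_pos
  have e1 : (σ₁ + σ₂) • (z.snd - (σ₂ / (σ₁ + σ₂)) • ζ.snd) = (σ₁ + σ₂) • z.snd - σ₂ • ζ.snd := by
    rw [smul_sub, smul_smul, mul_div_cancel₀ _ hσ]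
  have e2 : (σ₁ + σ₂) • z.snd - σ₂ • ζ.snd = σ₁ • z.snd - σ₂ • (ζ.snd - z.snd) := by
    module
  have n1 : |σ₁ + σ₂| * ‖z.snd - (σ₂ / (σ₁ + σ₂)) • ζ.snd‖ =
      ‖(σ₁ + σ₂) • z.snd - σ₂ • ζ.snd‖ := by
    rw [← e1, norm_smul, Real.norm_eq_abs]
  have a1 := norm_sub_norm_le ((σ₁ + σ₂) • z.snd) (σ₂ • ζ.snd)
  have a2 := norm_sub_norm_le (σ₁ • z.snd) (σ₂ • (ζ.snd - z.snd))
  have a3 := norm_sub_norm_le (σ₂ • (ζ.snd - z.snd)) (σ₁ • z.snd)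
  rw [norm_sub_rev] at a3
  rw [← e2, ← n1, norm_smul, norm_smul, Real.norm_eq_abs, Real.norm_eq_abs] at a2 a3
  rw [← n1, norm_smul, norm_smul, Real.norm_eq_abs, Real.norm_eq_abs] at a1
  simp only [freq, WithLp.sub_snd]
  refine ⟨?_, ?_, ?_⟩ <;> nlinarith

/-- The elementary estimate behind `gradient_lower_bound`: `a` is the size of the smallest frequency,
`b` that of another one, and `G` bounds the gradient in one of the forms of `le_norm_gradient`. -/
theorem quarter_mul_le {P Q S κ m M a b G : ℝ} (hP : P ≤ S) (hQ : κ ≤ Q) (hκ : 0 < κ) (hκS : κ ≤ S)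
    (hm : 0 ≤ m) (hM : 16 * S / κ * m ≤ M) (ha0 : 0 ≤ a) (ha : a ≤ 2 * m) (hb : M / 2 - 2 * m ≤ b)
    (hG : Q * b - P * a ≤ G) : κ * M / 4 ≤ G := by
  have hM' : 16 * S * m ≤ κ * M := by
    have := mul_le_mul_of_nonneg_left hM hκ.le
    calc 16 * S * m = κ * (16 * S / κ * m) := by field_simp
      _ ≤ _ := this
  have hSm : κ * m ≤ S * m := by gcongr
  have hb0 : 0 ≤ M / 2 - 2 * m := by
    by_contra! h
    nlinarith
  have h1 : κ * (M / 2 - 2 * m) ≤ Q * b := mul_le_mul hQ hb hb0 (hκ.le.trans hQ)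
  have h2 : P * a ≤ S * (2 * m) := mul_le_mul hP ha ha0 (hκ.le.trans hκS)
  linarith

theorem min_eq_or_eq_or_eq (a b c : ℝ) :
    min a (min b c) = a ∨ min a (min b c) = b ∨ min a (min b c) = c := by
  rcases min_choice a (min b c) with h | h
  · exact Or.inl h
  · rw [h]; exact Or.inr (min_choice b c)

theorem max_eq_or_eq_or_eq (a b c : ℝ) :
    max a (max b c) = a ∨ max a (max b c) = b ∨ max a (max b c) = c := by
  rcases max_choice a (max b c) with h | h
  · exact Or.inl h
  · rw [h]; exact Or.inr (max_choice b c)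

/-- If one of the three frequencies is much smaller than the largest one, then the gradient of the
resonance function is at least of the size of the largest frequency. -/
theorem gradient_lower_bound {σ₁ σ₂ κ : ℝ} (hσ : σ₁ + σ₂ ≠ 0) (hκ : 0 < κ) (h₁ : κ ≤ |σ₁|)
    (h₂ : κ ≤ |σ₂|) (h₁₂ : κ ≤ |σ₁ + σ₂|) {N₁ N₂ N₃ : ℝ} (hN₁ : 1 ≤ N₁) (hN₂ : 1 ≤ N₂)
    (hN₃ : 1 ≤ N₃)
    (hK : 16 * (|σ₁| + |σ₂|) / κ * min N₁ (min N₂ N₃) ≤ max N₁ (max N₂ N₃)) {z ζ : SpaceTime d}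
    (hz : z ∈ freqShell d N₁) (hζz : ζ - z ∈ freqShell d N₂) (hζ : ζ ∈ freqShell d N₃) :
    κ * max N₁ (max N₂ N₃) / (8 * Real.pi * |σ₁ + σ₂|) ≤
      ‖z.snd - (σ₂ / (σ₁ + σ₂)) • ζ.snd‖ := by
  have hπ := Real.pi_pos
  have hs : 0 < |σ₁ + σ₂| := abs_pos.2 hσ
  obtain ⟨g1, g2, g3⟩ := le_norm_gradient hσ z ζ
  have t1 : freq ζ ≤ freq z + freq (ζ - z) := by simpa using freq_add_le z (ζ - z)
  have t2 : freq z ≤ freq ζ + freq (ζ - z) := by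
    have := freq_add_le ζ (-(ζ - z))
    rw [freq_neg] at this
    simpa using this
  have t3 : freq (ζ - z) ≤ freq ζ + freq z := by
    have := freq_add_le ζ (-z)
    rwa [freq_neg, ← sub_eq_add_neg] at this
  obtain ⟨u1, v1⟩ := hz
  obtain ⟨u2, v2⟩ := hζz
  obtain ⟨u3, v3⟩ := hζ
  set m := min N₁ (min N₂ N₃)
  set M := max N₁ (max N₂ N₃)
  set G := 2 * Real.pi * |σ₁ + σ₂| * ‖z.snd - (σ₂ / (σ₁ + σ₂)) • ζ.snd‖ with hG
  suffices h : κ * M / 4 ≤ G by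
    rw [div_le_iff₀ (by positivity)]
    rw [hG] at h
    linarith
  have hm1 : 1 ≤ m := le_min hN₁ (le_min hN₂ hN₃)
  have hκS : κ ≤ |σ₁| + |σ₂| := h₁.trans (by simp)
  have hM16 : 16 * m ≤ M := by
    refine le_trans ?_ hK
    rw [mul_div_assoc]
    have : 1 ≤ (|σ₁| + |σ₂|) / κ := (one_le_div hκ).2 hκS
    nlinarith
  -- One of the frequencies is `M ≥ 2`, so that the lower bound `M / 2` of its shell is available. By
  -- the triangle inequality each frequency other than the smallest one is at least `M / 2 - 2 m`.
  have hM3 : M = N₁ ∨ M = N₂ ∨ M = N₃ := max_eq_or_eq_or_eq N₁ N₂ N₃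
  have hm3 : m = N₁ ∨ m = N₂ ∨ m = N₃ := min_eq_or_eq_or_eq N₁ N₂ N₃
  have f1 := freq_nonneg z
  have f2 := freq_nonneg (ζ - z)
  have f3 := freq_nonneg ζ
  rcases hm3 with h | h | h
  · refine quarter_mul_le (by simp : |σ₁| ≤ |σ₁| + |σ₂|) h₂ hκ hκS (by linarith) hK f1
      (by rw [h]; exact u1) ?_ g1
    rcases hM3 with h' | h' | h'
    · linarith
    · have := v2 (by linarith); linarith
    · have := v3 (by linarith); linarith
  · refine quarter_mul_le (by simp : |σ₂| ≤ |σ₁| + |σ₂|) h₁ hκ hκS (by linarith) hK f2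
      (by rw [h]; exact u2) ?_ g2
    rcases hM3 with h' | h' | h'
    · have := v1 (by linarith); linarith
    · linarith
    · have := v3 (by linarith); linarith
  · refine quarter_mul_le (by simp : |σ₂| ≤ |σ₁| + |σ₂|) h₁₂ hκ hκS (by linarith) hK f3
      (by rw [h]; exact u3) ?_ g3
    rcases hM3 with h' | h' | h'
    · have := v1 (by linarith); linarith
    · have := v2 (by linarith); linarith
    · linarith

/-- The volume bound for the case that the smallest frequency `m` is comparable to the largest
frequency `M`. Here the gradient of the resonance function may vanish, and dimension at least two
is needed. -/
theorem volume_comparable_le (k : ℕ) {σ₁ σ₂ K : ℝ} (hσ : σ₁ + σ₂ ≠ 0) (hK : 0 < K) :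
    ∃ C : ℝ, 0 < C ∧ ∀ (m M L₁ L₂ : ℝ) (ζ : SpaceTime (k + 2)),
      1 ≤ m → 0 < M → M ≤ K * m → 0 ≤ L₁ → 0 ≤ L₂ →
      volume {z : SpaceTime (k + 2) | |modulation σ₁ z| ≤ 2 * L₁ ∧
        |modulation σ₂ (ζ - z)| ≤ 2 * L₂ ∧
        ‖z.snd - (σ₂ / (σ₁ + σ₂)) • ζ.snd‖ ≤ (1 + |σ₂ / (σ₁ + σ₂)|) * M} ≤
      ENNReal.ofReal (C * (L₁ * L₂ * m ^ (k + 1) / M)) := by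
  obtain ⟨C, hC, hvol⟩ := volume_modulation_le_of_two_le k hσ
  set c := 1 + |σ₂ / (σ₁ + σ₂)|
  have hc : 0 < c := by positivity
  refine ⟨C * 4 * (c * K) ^ k * K, by positivity, fun m M L₁ L₂ ζ hm hM hMm hL₁ hL₂ => ?_⟩
  have hm0 : 0 < m := by linarith
  refine (hvol (2 * L₁) (2 * L₂) _ ζ (by positivity) (by positivity) (by positivity)).trans ?_
  refine ENNReal.ofReal_le_ofReal ?_
  have h1 : 1 ≤ K * m / M := (one_le_div hM).2 hMm
  calc C * (2 * L₁ * (2 * L₂) * (c * M) ^ k)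
      ≤ C * (2 * L₁ * (2 * L₂) * (c * (K * m)) ^ k) := by gcongr
    _ = C * 4 * (c * K) ^ k * (L₁ * L₂ * m ^ k) := by
        simp only [mul_pow]
        ring
    _ ≤ C * 4 * (c * K) ^ k * (L₁ * L₂ * m ^ k) * (K * m / M) :=
        le_mul_of_one_le_right (by positivity) h1
    _ = _ := by ring

/-- The frequencies in a shell of size `N` with modulation at most `2 L`. -/
def paraboloidRegion (d : ℕ) (σ N L : ℝ) : Set (SpaceTime d) :=
  {z | |modulation σ z| ≤ 2 * L ∧ z ∈ freqShell d N}

/-- If the set of those `z` in a ball of radius `min N₁ N₂ N₃` at which `f z * g (ζ - z)` does not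
vanish has volume at most `V`, then the `L²` estimate holds with constant `3 ^ d * V`. If `N₁` or
`N₂` is minimal this is the Cauchy–Schwarz inequality, and if `N₃` is minimal, almost
orthogonality. -/
theorem setLIntegral_sq_convolution_le_of_ball {σ₁ σ₂ N₁ N₂ N₃ L₁ L₂ : ℝ} (hN₃ : 1 ≤ N₃)
    {f g : SpaceTime d → ℝ≥0∞} (hf : Measurable f)
    (hg : Measurable g) (hfs : ∀ z, f z ≠ 0 → z ∈ paraboloidRegion d σ₁ N₁ L₁)
    (hgs : ∀ z, g z ≠ 0 → z ∈ paraboloidRegion d σ₂ N₂ L₂) {V : ℝ≥0∞}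
    (hV : ∀ q, ∀ ζ ∈ freqShell d N₃,
      volume {z | ‖z.snd - q‖ ≤ min N₁ (min N₂ N₃) ∧ f z ≠ 0 ∧ g (ζ - z) ≠ 0} ≤ V) :
    ∫⁻ ζ in freqShell d N₃, (∫⁻ z, f z * g (ζ - z)) ^ 2 ≤
      3 ^ d * (V * ((∫⁻ z, f z ^ 2) * ∫⁻ z, g z ^ 2)) := by
  have hD := measurableSet_freqShell (d := d) N₃
  have h3 : ∀ a : ℝ≥0∞, a ≤ 3 ^ d * a := fun a =>
    le_mul_of_one_le_left' (one_le_pow_of_one_le' (by norm_num) d)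
  rcases min_eq_or_eq_or_eq N₁ N₂ N₃ with h | h | h <;> rw [h] at hV
  · refine (setLIntegral_sq_convolution_le hf hg hD (m := V)
      fun ζ hζ => (measure_mono ?_).trans (hV 0 ζ hζ)).trans (h3 _)
    rintro z ⟨hz2, hz3⟩
    refine ⟨?_, hz2, hz3⟩
    rw [sub_zero]
    exact norm_snd_le_of_freq_le (hfs z hz2).2.1
  · refine (setLIntegral_sq_convolution_le hf hg hD (m := V)
      fun ζ hζ => (measure_mono ?_).trans (hV ζ.snd ζ hζ)).trans (h3 _)
    rintro z ⟨hz2, hz3⟩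
    refine ⟨?_, hz2, hz3⟩
    rw [norm_sub_rev, ← WithLp.sub_snd]
    exact norm_snd_le_of_freq_le (hgs _ hz3).2.1
  · have hp : Measurable fun z : SpaceTime d => z.snd := Continuous.measurable (by fun_prop)
    have := setLIntegral_sq_convolution_le_of_local hf hg hD hp (fun _ _ => rfl) (r := N₃)
      (by linarith) (fun ζ hζ => by
        have := norm_snd_le_of_freq_le hζ.1
        linarith) (m := V) hV
    rwa [finrank_euclideanSpace_fin] at this

/-- The bilinear estimate for functions supported in frequency shells and in neighbourhoods of the
paraboloids `τ + σᵢ |ξ|² = 0`. -/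
theorem exists_setLIntegral_sq_convolution_le (n : ℕ) {σ₁ σ₂ : ℝ} (hσ₁ : σ₁ ≠ 0) (hσ₂ : σ₂ ≠ 0)
    (hσ : σ₁ + σ₂ ≠ 0) :
    ∃ K C : ℝ, 0 < C ∧ ∀ N₁ N₂ N₃ L₁ L₂ : ℝ, 1 ≤ N₁ → 1 ≤ N₂ → 1 ≤ N₃ → 1 ≤ L₁ → 1 ≤ L₂ →
      (n = 0 → K * min N₁ (min N₂ N₃) ≤ max N₁ (max N₂ N₃)) →
      ∀ f g : SpaceTime (n + 1) → ℝ≥0∞, Measurable f → Measurable g →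
        (∀ z, f z ≠ 0 → z ∈ paraboloidRegion (n + 1) σ₁ N₁ L₁) →
        (∀ z, g z ≠ 0 → z ∈ paraboloidRegion (n + 1) σ₂ N₂ L₂) →
        ∫⁻ ζ in freqShell (n + 1) N₃, (∫⁻ z, f z * g (ζ - z)) ^ 2 ≤
          ENNReal.ofReal (C * (L₁ * L₂ * min N₁ (min N₂ N₃) ^ n / max N₁ (max N₂ N₃))) *
            ((∫⁻ z, f z ^ 2) * ∫⁻ z, g z ^ 2) := by
  have hπ := Real.pi_pos
  obtain ⟨κ, hκ, h₁, h₂, h₁₂⟩ : ∃ κ : ℝ, 0 < κ ∧ κ ≤ |σ₁| ∧ κ ≤ |σ₂| ∧ κ ≤ |σ₁ + σ₂| :=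
    ⟨min |σ₁| (min |σ₂| |σ₁ + σ₂|),
      lt_min (abs_pos.2 hσ₁) (lt_min (abs_pos.2 hσ₂) (abs_pos.2 hσ)), min_le_left _ _,
      (min_le_right _ _).trans (min_le_left _ _), (min_le_right _ _).trans (min_le_right _ _)⟩
  have hs : 0 < |σ₁ + σ₂| := abs_pos.2 hσ
  obtain ⟨K, hKdef⟩ : ∃ K, K = 16 * (|σ₁| + |σ₂|) / κ := ⟨_, rfl⟩
  have hK0 : 0 < K := by
    have : 0 < |σ₁| := abs_pos.2 hσ₁
    rw [hKdef]; positivity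
  obtain ⟨C₁, hC₁, hvol₁⟩ := volume_modulation_inter_closedBall_le n hσ
  obtain ⟨C₂, hC₂, hvol₂⟩ : ∃ C₂ : ℝ, 0 < C₂ ∧ (n ≠ 0 → ∀ (m M L₁ L₂ : ℝ) (ζ : SpaceTime (n + 1)),
      1 ≤ m → 0 < M → M ≤ K * m → 0 ≤ L₁ → 0 ≤ L₂ →
      volume {z : SpaceTime (n + 1) | |modulation σ₁ z| ≤ 2 * L₁ ∧
        |modulation σ₂ (ζ - z)| ≤ 2 * L₂ ∧
        ‖z.snd - (σ₂ / (σ₁ + σ₂)) • ζ.snd‖ ≤ (1 + |σ₂ / (σ₁ + σ₂)|) * M} ≤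
      ENNReal.ofReal (C₂ * (L₁ * L₂ * m ^ n / M))) := by
    rcases n with _ | k
    · exact ⟨1, one_pos, fun h => absurd rfl h⟩
    · obtain ⟨C, hC, h⟩ := volume_comparable_le k (σ₁ := σ₁) (σ₂ := σ₂) hσ hK0
      exact ⟨C, hC, fun _ => h⟩
  -- the constant of `hvol₁` for `lᵢ = 2 Lᵢ` and the `ρ` of `gradient_lower_bound`
  obtain ⟨C₃, hC₃⟩ : ∃ C₃, C₃ = 32 * C₁ * Real.pi * |σ₁ + σ₂| / κ := ⟨_, rfl⟩
  have hC₃0 : 0 < C₃ := by rw [hC₃]; positivity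
  refine ⟨K, 3 ^ (n + 1) * C₃ + C₂, by positivity, ?_⟩
  intro N₁ N₂ N₃ L₁ L₂ hN₁ hN₂ hN₃ hL₁ hL₂ hn f g hf hg hfs hgs
  have hm1 : 1 ≤ min N₁ (min N₂ N₃) := le_min hN₁ (le_min hN₂ hN₃)
  have hM1 : 1 ≤ max N₁ (max N₂ N₃) := hN₁.trans (le_max_left _ _)
  by_cases hKM : K * min N₁ (min N₂ N₃) ≤ max N₁ (max N₂ N₃)
  · rw [hKdef] at hKM
    refine (setLIntegral_sq_convolution_le_of_ball hN₃ hf hg hfs hgs (V := ENNReal.ofReal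
      (C₃ * (L₁ * L₂ * min N₁ (min N₂ N₃) ^ n / max N₁ (max N₂ N₃)))) fun q ζ hζ =>
        (measure_mono ?_).trans ((hvol₁ (2 * L₁) (2 * L₂) (min N₁ (min N₂ N₃))
          (κ * max N₁ (max N₂ N₃) / (8 * Real.pi * |σ₁ + σ₂|)) ζ q (by positivity)
          (by positivity) (by positivity) (by positivity)).trans_eq ?_)).trans ?_
    · rintro z ⟨hz1, hz2, hz3⟩
      exact ⟨(hfs z hz2).1, (hgs _ hz3).1, hz1, gradient_lower_bound hσ hκ h₁ h₂ h₁₂ hN₁ hN₂ hN₃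
        hKM (hfs z hz2).2 (hgs _ hz3).2 hζ⟩
    · congr 1
      rw [hC₃]
      field_simp
      ring
    · rw [← mul_assoc]
      refine mul_le_mul_left ?_ _
      rw [← ENNReal.ofReal_ofNat 3, ← ENNReal.ofReal_pow (by norm_num),
        ← ENNReal.ofReal_mul (by positivity), ← mul_assoc]
      refine ENNReal.ofReal_le_ofReal (mul_le_mul_of_nonneg_right ?_ (by positivity))
      linarith
  · have hn0 : n ≠ 0 := fun h => hKM (hn h)
    push Not at hKM
    refine (setLIntegral_sq_convolution_le hf hg (measurableSet_freqShell N₃)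
      (m := ENNReal.ofReal (C₂ * (L₁ * L₂ * min N₁ (min N₂ N₃) ^ n / max N₁ (max N₂ N₃))))
      fun ζ hζ => (measure_mono ?_).trans (hvol₂ hn0 _ _ L₁ L₂ ζ hm1 (by linarith) hKM.le
        (by linarith) (by linarith))).trans ?_
    · rintro z ⟨hz2, hz3⟩
      refine ⟨(hfs z hz2).1, (hgs _ hz3).1, ?_⟩
      have b1 : ‖z.snd‖ ≤ max N₁ (max N₂ N₃) :=
        (norm_snd_le_of_freq_le (hfs z hz2).2.1).trans (le_max_left _ _)
      have b2 : ‖ζ.snd‖ ≤ max N₁ (max N₂ N₃) := (norm_snd_le_of_freq_le hζ.1).trans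
        ((le_max_right _ _).trans (le_max_right _ _))
      refine (norm_sub_le _ _).trans ?_
      rw [norm_smul, Real.norm_eq_abs, add_mul, one_mul]
      exact add_le_add b1 (mul_le_mul_of_nonneg_left b2 (abs_nonneg _))
    · refine mul_le_mul_left (ENNReal.ofReal_le_ofReal
        (mul_le_mul_of_nonneg_right ?_ (by positivity))) _
      have : 0 < 3 ^ (n + 1) * C₃ := by positivity
      linarith

end FourierSide

/-! ### Frequency-localized functions -/

section Localization

theorem Cutoff.eq_zero (χ : Cutoff) {t : ℝ} (ht : 2 ≤ |t|) : χ.toFun t = 0 := by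
  by_contra h
  have := χ.tsupport_subset (subset_tsupport _ (Function.mem_support.2 h))
  exact absurd (abs_lt.2 this) (not_lt.2 ht)

theorem Cutoff.psiN_ne_zero (χ : Cutoff) {N t : ℝ} (hN : 1 ≤ N) (h : χ.psiN N t ≠ 0) :
    |t| ≤ 2 * N ∧ (2 ≤ N → N / 2 ≤ |t|) := by
  have hN0 : 0 < N := by linarith
  by_cases h1 : N = 1
  · subst h1
    refine ⟨?_, fun h2 => by norm_num at h2⟩
    by_contra! hcon
    exact h (by simpa [psiN] using χ.eq_zero (by linarith))
  have habs : |N⁻¹ * t| = |t| / N := by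
    rw [abs_mul, abs_inv, abs_of_pos hN0]; field_simp
  have habs2 : |2 * (N⁻¹ * t)| = 2 * (|t| / N) := by rw [abs_mul, habs]; norm_num
  simp only [psiN, h1, if_false, psi] at h
  constructor
  · by_contra! hcon
    have h2 : 2 ≤ |t| / N := by rw [le_div_iff₀ hN0]; exact hcon.le
    exact h (by rw [χ.eq_zero (by rwa [habs]), χ.eq_zero (by rw [habs2]; linarith), sub_zero])
  · intro _
    by_contra! hcon
    have h2 : |t| / N ≤ 1 / 2 := by rw [div_le_iff₀ hN0]; linarith
    exact h (by rw [χ.eq_one _ (by rw [habs]; linarith), χ.eq_one _ (by rw [habs2]; linarith),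
      sub_self])

theorem Cutoff.exists_uniform_bound_psiN (χ : Cutoff) :
    ∃ B : ℝ, 0 < B ∧ ∀ N t, ‖χ.psiN N t‖ ≤ B := by
  obtain ⟨B, hB⟩ := χ.exists_bound
  have h0 : 0 ≤ B := (norm_nonneg _).trans (hB 0)
  refine ⟨B + B + 1, by linarith, fun N t => ?_⟩
  unfold psiN psi
  split_ifs
  · linarith [hB t]
  · linarith [norm_sub_le (χ.toFun (N⁻¹ * t)) (χ.toFun (2 * (N⁻¹ * t))), hB (N⁻¹ * t),
      hB (2 * (N⁻¹ * t))]

theorem IsDyadic.one_le {N : ℝ} (h : IsDyadic N) : 1 ≤ N := by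
  obtain ⟨n, rfl⟩ := h
  exact one_le_pow₀ (by norm_num)

variable {d : ℕ}

theorem fourier_fourierMult_ae_eq (m : SpaceTime d → ℂ) (hm : MemLp m ∞ volume) (u : L2tx d) :
    (𝓕 (fourierMult m hm u) : L2tx d) =ᵐ[volume] fun z => m z * (𝓕 u : L2tx d) z := by
  rw [fourierMult, fourier_fourierInv_eq]
  filter_upwards [Lp.coeFn_lpSMul (r := 2) (hm.toLp m) (𝓕 u : L2tx d), hm.coeFn_toLp] with z h1 h2
  rw [h1, Pi.smul_apply', h2, smul_eq_mul]

theorem measurableSet_paraboloidRegion (σ N L : ℝ) :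
    MeasurableSet (paraboloidRegion d σ N L) :=
  (measurableSet_le (continuous_modulation σ).abs.measurable measurable_const).inter
    (measurableSet_freqShell N)

theorem volume_paraboloidRegion_lt_top (σ N L : ℝ) : volume (paraboloidRegion d σ N L) < ∞ := by
  have hπ := Real.pi_pos
  set r := (2 * L + |σ| * (2 * N) ^ 2) / (2 * Real.pi)
  have hsub : paraboloidRegion d σ N L ⊆ (WithLp.ofLp : SpaceTime d → _) ⁻¹'
      (Metric.closedBall (0 : ℝ) r ×ˢ Metric.closedBall (0 : EuclideanSpace ℝ (Fin d)) N) := by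
    rintro z ⟨h1, h2, -⟩
    refine ⟨?_, mem_closedBall_zero_iff.2 (norm_snd_le_of_freq_le h2)⟩
    rw [mem_closedBall_zero_iff, Real.norm_eq_abs]
    change |z.fst| ≤ r
    rw [le_div_iff₀ (by positivity)]
    have hf := freq_nonneg z
    have h3 : |σ * freq z ^ 2| ≤ |σ| * (2 * N) ^ 2 := by
      rw [abs_mul, abs_of_nonneg (sq_nonneg (freq z))]
      gcongr
    calc |z.fst| * (2 * Real.pi) = |2 * Real.pi * z.fst| := by
          rw [abs_mul, abs_of_pos (by positivity : 0 < 2 * Real.pi), mul_comm]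
      _ = |modulation σ z - σ * freq z ^ 2| := by rw [modulation, add_sub_cancel_right]
      _ ≤ |modulation σ z| + |σ * freq z ^ 2| := abs_sub _ _
      _ ≤ _ := add_le_add h1 h3
  refine (measure_mono hsub).trans_lt ?_
  rw [(WithLp.volume_preserving_ofLp ℝ (EuclideanSpace ℝ (Fin d))).measure_preimage
    (measurableSet_closedBall.prod measurableSet_closedBall).nullMeasurableSet,
    Measure.volume_eq_prod, Measure.prod_prod]
  exact ENNReal.mul_lt_top measure_closedBall_lt_top measure_closedBall_lt_top

/-- The Fourier transform of `Q_L^σ P_N u` is supported in `paraboloidRegion d σ N L`. -/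
theorem fourier_Q_P_ae_eq_indicator (χ : Cutoff) {σ N L : ℝ} (hN : 1 ≤ N) (hL : 1 ≤ L)
    (u : L2tx d) :
    (𝓕 (Q χ σ L (P χ N u)) : L2tx d) =ᵐ[volume]
      (paraboloidRegion d σ N L).indicator (𝓕 (Q χ σ L (P χ N u)) : L2tx d) := by
  filter_upwards [fourier_fourierMult_ae_eq _ (χ.memLp_symbol L (continuous_modulation σ))
    (P χ N u), fourier_fourierMult_ae_eq _ (χ.memLp_symbol N continuous_freq) u] with z h1 h2
  by_cases hz : z ∈ paraboloidRegion d σ N L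
  · rw [Set.indicator_of_mem hz]
  rw [Set.indicator_of_notMem hz]
  by_contra hne
  refine hz ?_
  change (𝓕 (fourierMult _ _ (P χ N u)) : L2tx d) z ≠ 0 at hne
  change (𝓕 (P χ N u) : L2tx d) z = _ at h2
  rw [h1, h2] at hne
  have hL' : χ.psiN L (modulation σ z) ≠ 0 := fun h => hne (by simp [h])
  have hN' : χ.psiN N (freq z) ≠ 0 := fun h => hne (by simp [h])
  have hf := χ.psiN_ne_zero hN hN'
  rw [abs_of_nonneg (freq_nonneg z)] at hf
  exact ⟨(χ.psiN_ne_zero hL hL').1, hf⟩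

theorem enorm_sq_eq_lintegral (f : L2tx d) : ‖f‖ₑ ^ 2 = ∫⁻ z, ‖f z‖ₑ ^ 2 := by
  have h := eLpNorm_nnreal_pow_eq_lintegral (f := f) (μ := volume) (p := 2) (by norm_num)
  rw [Lp.enorm_def]
  simpa using h

theorem enorm_fourier_eq (f : L2tx d) : ‖(𝓕 f : L2tx d)‖ₑ = ‖f‖ₑ := by
  rw [← ofReal_norm, ← ofReal_norm, Lp.norm_fourier_eq]

theorem integrable_of_memLp_of_ae_eq_indicator {f : SpaceTime d → ℂ} (hf : MemLp f 2 volume)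
    {A : Set (SpaceTime d)} (hA : MeasurableSet A) (hAt : volume A < ∞)
    (h : f =ᵐ[volume] A.indicator f) : Integrable f := by
  have : IsFiniteMeasure (volume.restrict A) := ⟨by rwa [Measure.restrict_apply_univ]⟩
  have h1 : IntegrableOn f A := (hf.restrict A).integrable (by norm_num)
  exact ((integrable_indicator_iff hA).2 h1).congr h.symm

end Localization

/-! ### From the Fourier side to the product estimate -/

section Product

open Convolution ContinuousLinearMap

variable {d : ℕ}

theorem enorm_convolution_le {f g : SpaceTime d → ℂ} {A B : Set (SpaceTime d)}
    (hf : f =ᵐ[volume] A.indicator f) (hg : g =ᵐ[volume] B.indicator g) (ζ : SpaceTime d) :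
    ‖(f ⋆[mul ℂ ℂ, volume] g) ζ‖ₑ ≤ ∫⁻ z, ‖A.indicator f z‖ₑ * ‖B.indicator g (ζ - z)‖ₑ := by
  rw [convolution_congr (mul ℂ ℂ) hf hg]
  refine (enorm_integral_le_lintegral_enorm _).trans_eq ?_
  simp [enorm_mul]

/-- The convolution of two `L²` functions supported in sets of finite measure is in `L²`. -/
theorem memLp_convolution {f g : SpaceTime d → ℂ} (hf : MemLp f 2 volume) (hg : MemLp g 2 volume)
    (hfm : StronglyMeasurable f) (hgm : StronglyMeasurable g)
    {A B : Set (SpaceTime d)} (hA : MeasurableSet A) (hB : MeasurableSet B) (hAt : volume A < ∞)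
    (hBt : volume B < ∞) (hfA : f =ᵐ[volume] A.indicator f) (hgB : g =ᵐ[volume] B.indicator g) :
    MemLp (f ⋆[mul ℂ ℂ, volume] g) 2 volume := by
  have hfi := integrable_of_memLp_of_ae_eq_indicator hf hA hAt hfA
  have hgi := integrable_of_memLp_of_ae_eq_indicator hg hB hBt hgB
  refine ⟨(hfi.integrable_convolution (mul ℂ ℂ) hgi).aestronglyMeasurable, ?_⟩
  rw [eLpNorm_lt_top_iff_lintegral_rpow_enorm_lt_top two_ne_zero ENNReal.ofNat_ne_top]
  have hf2 := lintegral_rpow_enorm_lt_top_of_eLpNorm_lt_top two_ne_zero ENNReal.ofNat_ne_top hf.2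
  have hg2 := lintegral_rpow_enorm_lt_top_of_eLpNorm_lt_top two_ne_zero ENNReal.ofNat_ne_top hg.2
  simp only [ENNReal.toReal_ofNat, ENNReal.rpow_ofNat] at hf2 hg2 ⊢
  have h := setLIntegral_sq_convolution_le (μ := volume)
    (f := fun z => ‖A.indicator f z‖ₑ) (g := fun z => ‖B.indicator g z‖ₑ)
    (hfm.indicator hA).enorm (hgm.indicator hB).enorm MeasurableSet.univ (m := volume A)
    (fun x _ => measure_mono fun y hy => by
      by_contra hyA
      exact hy.1 (by simp [hyA]))
  rw [Measure.restrict_univ] at h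
  refine (lintegral_mono fun ζ => pow_le_pow_left' (enorm_convolution_le hfA hgB ζ) 2).trans_lt
    (h.trans_lt (ENNReal.mul_lt_top hAt (ENNReal.mul_lt_top ?_ ?_)))
  · exact (lintegral_mono fun z =>
      pow_le_pow_left' (enorm_indicator_le_enorm_self _ _) 2).trans_lt hf2
  · exact (lintegral_mono fun z =>
      pow_le_pow_left' (enorm_indicator_le_enorm_self _ _) 2).trans_lt hg2

theorem enorm_P_sq_le (χ : Cutoff) {B : ℝ} (hB : ∀ N t, ‖χ.psiN N t‖ ≤ B) {N : ℝ} (hN : 1 ≤ N)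
    (u : L2tx d) :
    ‖P χ N u‖ₑ ^ 2 ≤ ENNReal.ofReal B ^ 2 * ∫⁻ z in freqShell d N, ‖(𝓕 u : L2tx d) z‖ₑ ^ 2 := by
  rw [← enorm_fourier_eq, enorm_sq_eq_lintegral,
    ← lintegral_const_mul' _ _ (ENNReal.pow_ne_top ENNReal.ofReal_ne_top),
    ← lintegral_indicator (measurableSet_freqShell N)]
  refine lintegral_mono_ae ?_
  filter_upwards [fourier_fourierMult_ae_eq _ (χ.memLp_symbol N continuous_freq) u] with z hz
  change (𝓕 (P χ N u) : L2tx d) z = _ at hz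
  rw [hz]
  by_cases h0 : χ.psiN N (freq z) = 0
  · simp [h0]
  have hmem := χ.psiN_ne_zero hN h0
  rw [abs_of_nonneg (freq_nonneg z)] at hmem
  rw [Set.indicator_of_mem (show z ∈ freqShell d N from hmem), ← mul_pow, enorm_mul]
  gcongr
  rw [← ofReal_norm, Complex.norm_real]
  exact ENNReal.ofReal_le_ofReal (hB N _)

end Product

theorem mainTheorem7 (χ : Cutoff) (d : ℕ) (hd : 1 ≤ d) (σ₁ σ₂ : ℝ)
    (hσ₁ : σ₁ ≠ 0) (hσ₂ : σ₂ ≠ 0) (hσ : σ₁ + σ₂ ≠ 0) :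
    ∃ K C : ℝ, 0 < C ∧
      ∀ N₁ N₂ N₃ L₁ L₂ : ℝ,
        IsDyadic N₁ → IsDyadic N₂ → IsDyadic N₃ → IsDyadic L₁ → IsDyadic L₂ →
        (d = 1 → K * min N₁ (min N₂ N₃) ≤ max N₁ (max N₂ N₃)) →
        ∀ u₁ u₂ : L2tx d,
          ∃ h : MemLp (fun z => Q χ σ₁ L₁ (P χ N₁ u₁) z * Q χ σ₂ L₂ (P χ N₂ u₂) z) 2 volume,
            ‖P χ N₃ (h.toLp _)‖ ≤
              C * min N₁ (min N₂ N₃) ^ ((d : ℝ) / 2 - 1)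
                * (min N₁ (min N₂ N₃) / max N₁ (max N₂ N₃)) ^ (1 / 2 : ℝ)
                * L₁ ^ (1 / 2 : ℝ) * L₂ ^ (1 / 2 : ℝ)
                * ‖Q χ σ₁ L₁ (P χ N₁ u₁)‖ * ‖Q χ σ₂ L₂ (P χ N₂ u₂)‖ := by
  obtain ⟨n, rfl⟩ : ∃ n, d = n + 1 := ⟨d - 1, by omega⟩
  obtain ⟨K, C, hC, hest⟩ := exists_setLIntegral_sq_convolution_le n hσ₁ hσ₂ hσ
  obtain ⟨B, hB0, hB⟩ := χ.exists_uniform_bound_psiN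
  refine ⟨K, B * √C, by positivity, ?_⟩
  intro N₁ N₂ N₃ L₁ L₂ hN₁ hN₂ hN₃ hL₁ hL₂ hK u₁ u₂
  replace hN₁ := hN₁.one_le
  replace hN₂ := hN₂.one_le
  replace hN₃ := hN₃.one_le
  replace hL₁ := hL₁.one_le
  replace hL₂ := hL₂.one_le
  have i₁ := fourier_Q_P_ae_eq_indicator χ (σ := σ₁) hN₁ hL₁ u₁
  have i₂ := fourier_Q_P_ae_eq_indicator χ (σ := σ₂) hN₂ hL₂ u₂
  generalize Q χ σ₁ L₁ (P χ N₁ u₁) = v at i₁ ⊢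
  generalize Q χ σ₂ L₂ (P χ N₂ u₂) = w at i₂ ⊢
  set f : L2tx (n + 1) := 𝓕 v with hf
  set g : L2tx (n + 1) := 𝓕 w with hg
  set A := paraboloidRegion (n + 1) σ₁ N₁ L₁
  set A' := paraboloidRegion (n + 1) σ₂ N₂ L₂
  have hA : MeasurableSet A := measurableSet_paraboloidRegion _ _ _
  have hA' : MeasurableSet A' := measurableSet_paraboloidRegion _ _ _
  have hAt : volume A < ∞ := volume_paraboloidRegion_lt_top _ _ _
  have hAt' : volume A' < ∞ := volume_paraboloidRegion_lt_top _ _ _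
  obtain ⟨h, hF⟩ := exists_memLp_fourier_mul_ae_eq v w
    (integrable_of_memLp_of_ae_eq_indicator (Lp.memLp f) hA hAt i₁)
    (integrable_of_memLp_of_ae_eq_indicator (Lp.memLp g) hA' hAt' i₂)
    (memLp_convolution (Lp.memLp f) (Lp.memLp g) (Lp.stronglyMeasurable f)
      (Lp.stronglyMeasurable g) hA hA' hAt hAt' i₁ i₂)
  refine ⟨h, ?_⟩
  set m := min N₁ (min N₂ N₃) with hm
  set M := max N₁ (max N₂ N₃) with hM
  have hm0 : 0 < m := by
    have : 1 ≤ m := le_min hN₁ (le_min hN₂ hN₃)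
    linarith
  have hM0 : 0 < M := by
    have : N₁ ≤ M := le_max_left _ _
    linarith
  set X := L₁ * L₂ * m ^ n / M with hX
  have hX0 : 0 ≤ X := by positivity
  have key : ‖P χ N₃ (h.toLp _)‖ₑ ^ 2 ≤
      ENNReal.ofReal B ^ 2 * (ENNReal.ofReal (C * X) * (‖v‖ₑ ^ 2 * ‖w‖ₑ ^ 2)) := by
    refine (enorm_P_sq_le χ hB hN₃ _).trans (mul_le_mul_right ?_ _)
    calc ∫⁻ z in freqShell (n + 1) N₃, ‖(𝓕 (h.toLp _) : L2tx (n + 1)) z‖ₑ ^ 2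
        ≤ ∫⁻ ζ in freqShell (n + 1) N₃,
            (∫⁻ z, ‖A.indicator f z‖ₑ * ‖A'.indicator g (ζ - z)‖ₑ) ^ 2 := by
          refine lintegral_mono_ae (ae_restrict_of_ae ?_)
          filter_upwards [hF] with ζ hζ
          rw [hζ]
          exact pow_le_pow_left' (enorm_convolution_le i₁ i₂ ζ) 2
      _ ≤ ENNReal.ofReal (C * X) *
            ((∫⁻ z, ‖A.indicator f z‖ₑ ^ 2) * ∫⁻ z, ‖A'.indicator g z‖ₑ ^ 2) := by
          refine hest N₁ N₂ N₃ L₁ L₂ hN₁ hN₂ hN₃ hL₁ hL₂ (fun h0 => hK (by omega))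
            (fun z => ‖A.indicator f z‖ₑ) (fun z => ‖A'.indicator g z‖ₑ)
            ((Lp.stronglyMeasurable f).indicator hA).enorm
            ((Lp.stronglyMeasurable g).indicator hA').enorm ?_ ?_
          · intro z hz
            by_contra hzA
            exact hz (by simp [A, hzA])
          · intro z hz
            by_contra hzA
            exact hz (by simp [A', hzA])
      _ ≤ ENNReal.ofReal (C * X) * (‖v‖ₑ ^ 2 * ‖w‖ₑ ^ 2) := by
          rw [← enorm_fourier_eq v, ← enorm_fourier_eq w, enorm_sq_eq_lintegral,
            enorm_sq_eq_lintegral]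
          gcongr <;> exact enorm_indicator_le_enorm_self _ _
  have key' : ‖P χ N₃ (h.toLp _)‖ ^ 2 ≤ B ^ 2 * (C * X * (‖v‖ ^ 2 * ‖w‖ ^ 2)) := by
    simp only [← ofReal_norm, ← ENNReal.ofReal_pow (norm_nonneg _), ← ENNReal.ofReal_pow hB0.le]
      at key
    rw [← ENNReal.ofReal_mul (by positivity), ← ENNReal.ofReal_mul (by positivity),
      ← ENNReal.ofReal_mul (by positivity), ENNReal.ofReal_le_ofReal_iff (by positivity)] at key
    exact key
  -- the powers in the claim combine to the square root of `X`, since `d = n + 1`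
  have hXsq : m ^ (((n + 1 : ℕ) : ℝ) / 2 - 1) * (m / M) ^ (1 / 2 : ℝ) * L₁ ^ (1 / 2 : ℝ) *
      L₂ ^ (1 / 2 : ℝ) = √X := by
    have e1 : m ^ (((n + 1 : ℕ) : ℝ) / 2 - 1) = (m ^ n / m) ^ (1 / 2 : ℝ) := by
      rw [← Real.rpow_natCast m n, ← Real.rpow_sub_one hm0.ne', ← Real.rpow_mul hm0.le]
      congr 1
      push_cast
      ring
    rw [e1, ← Real.mul_rpow (by positivity) (by positivity),
      ← Real.mul_rpow (by positivity) (by positivity),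
      ← Real.mul_rpow (by positivity) (by positivity), Real.sqrt_eq_rpow, hX]
    congr 1
    field_simp
  refine (Real.le_sqrt_of_sq_le key').trans_eq ?_
  rw [show B ^ 2 * (C * X * (‖v‖ ^ 2 * ‖w‖ ^ 2)) = C * X * (B * (‖v‖ * ‖w‖)) ^ 2 by ring,
    Real.sqrt_mul (by positivity), Real.sqrt_sq (by positivity), Real.sqrt_mul hC.le, ← hXsq]
  ring
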